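/- Let $d\in\mathbb N$. A set $S\subseteq\mathbb R^d$ is relatively separated if $\sup_{x\in\mathbb R^d}\#(S\cap B_1(x))<\infty$. A closed subspace $V\subseteq L^2(\mathbb R^d)$ (complex-valued functions) is called a localizable reproducing kernel Hilbert space if there are a relatively separated set $\Gamma\subseteq\mathbb R^d$, a function $\Theta\in L^\infty(\mathbb R^d)$ with $\int_{\mathbb R^d}\|\Theta\|_{L^\infty(B_1(x))}\,dx<\infty$, and a frame $\{F_\gamma:\gamma\in\Gamma\}$ for $V$ consisting of continuous functions with $|F_\gamma(x)|\le\Theta(x-\gamma)$ for all $\gamma\in\Gamma$, $x\in\mathbb R^d$. For $p\in[1,\infty]$ let $$V^p=\Big\{\sum_{\gamma\in\Gamma}c_\gamma F_\gamma: c\in\ell^p(\Gamma)\Big\}\subseteq L^p(\mathbb R^d),$$ where the series converges unconditionally in $L^p$ if $p<\infty$ and in the weak$^*$ topology of $L^\infty=(L^1)'$ if $p=\infty$; the elements of $V^p$ are identified with their continuous representatives, and $V^p$ does not depend on the choice of the frame (that is, below, $V^p$ and $V^q$ may be formed with any two such frames for $V$). A set $\Lambda\subseteq\mathbb R^d$ is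 a sampling set for $V^p$ if there are constants $A,B>0$ with $A\|f\|_p\le\|(f(\lambda))_{\lambda\in\Lambda}\|_{\ell^p(\Lambda)}\le B\|f\|_p$ for all $f\in V^p$, and an interpolating set for $V^p$ if for every $a\in\ell^p(\Lambda)$ there is $f\in V^p$ with $f(\lambda)=a_\lambda$ for all $\lambda\in\Lambda$. Theorem. Let $V\subseteq L^2(\mathbb R^d)$ be a localizable reproducing kernel Hilbert space and let $\Lambda\subseteq\mathbb R^d$ be relatively separated. (i) If $\Lambda$ is a sampling set for $V^p$ for some $p\in[1,\infty]$, then $\Lambda$ is a sampling set for $V^q$ for all $q\in[1,\infty]$. (ii) If $\Lambda$ is an interpolating set for $V^p$ for some $p\in[1,\infty]$, then $\Lambda$ is an interpolating set for $V^q$ for all $q\in[1,\infty]$. -/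

import Mathlib

open MeasureTheory Filter Topology Metric
open scoped ENNReal

/-- A set `S ⊆ ℝ^d` is relatively separated if the number of its points in a unit ball is bounded,
uniformly over all unit balls. -/
def RelativelySeparated {d : ℕ} (S : Set (EuclideanSpace ℝ (Fin d))) : Prop :=
  ∃ N : ℕ, ∀ x : EuclideanSpace ℝ (Fin d), (S ∩ ball x 1).encard ≤ N

/-- Membership of `Θ` in the amalgam space `W(L^∞, L^1)(ℝ^d)`: `Θ ∈ L^∞` and
`∫ ‖Θ‖_{L^∞(B_1(x))} dx < ∞`. -/
def MemAmalgam {d : ℕ} (Θ : EuclideanSpace ℝ (Fin d) → ℝ) : Prop :=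
  MemLp Θ ∞ volume ∧ ∫⁻ x, eLpNorm Θ ∞ (volume.restrict (ball x 1)) < ∞

/-- The nodes, the envelope and the frame that witness that a subspace `V` of `L^2(ℝ^d)` is
localizable: `V` is a localizable RKHS if it is closed and carries such a system. -/
structure LocalizedFrame {d : ℕ}
    (V : Submodule ℂ (Lp ℂ 2 (volume : Measure (EuclideanSpace ℝ (Fin d))))) where
  /-- the set `Γ` of nodes -/
  nodes : Set (EuclideanSpace ℝ (Fin d))
  relativelySeparated : RelativelySeparated nodes
  /-- the envelope `Θ` -/
  envelope : EuclideanSpace ℝ (Fin d) → ℝ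
  memAmalgam : MemAmalgam envelope
  /-- the frame elements `F_γ` -/
  F : nodes → EuclideanSpace ℝ (Fin d) → ℂ
  continuous : ∀ γ, Continuous (F γ)
  localized : ∀ (γ : nodes) (x : EuclideanSpace ℝ (Fin d)),
    ‖F γ x‖ ≤ envelope (x - (γ : EuclideanSpace ℝ (Fin d)))
  memLp : ∀ γ, MemLp (F γ) 2 volume
  mem : ∀ γ, (memLp γ).toLp (F γ) ∈ V
  frame : ∃ A B : ℝ, 0 < A ∧ 0 < B ∧ ∀ f ∈ V,
    Summable (fun γ => ‖inner ℂ ((memLp γ).toLp (F γ)) f‖ ^ 2) ∧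
    A * ‖f‖ ^ 2 ≤ ∑' γ, ‖inner ℂ ((memLp γ).toLp (F γ)) f‖ ^ 2 ∧
    ∑' γ, ‖inner ℂ ((memLp γ).toLp (F γ)) f‖ ^ 2 ≤ B * ‖f‖ ^ 2

/-- The series `∑ u i` converges to `f`: unconditionally in the norm of `L^p` if `p < ∞`, and
(unconditionally) in the weak-* topology of `L^∞ = (L^1)'` if `p = ∞`. -/
def LpSeriesConverges {d : ℕ} {ι : Type*} (p : ℝ≥0∞)
    (u : ι → EuclideanSpace ℝ (Fin d) → ℂ) (f : EuclideanSpace ℝ (Fin d) → ℂ) : Prop :=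
  (p ≠ ∞ → Tendsto (fun s : Finset ι => eLpNorm (fun x => f x - ∑ i ∈ s, u i x) p volume)
    atTop (𝓝 0)) ∧
  (p = ∞ → ∀ g : EuclideanSpace ℝ (Fin d) → ℂ, Integrable g volume →
    HasSum (fun i => ∫ x, u i x * g x) (∫ x, f x * g x))

/-- The space `V^p = { ∑ c_γ F_γ : c ∈ ℓ^p(Γ) } ⊆ L^p(ℝ^d)`. Its elements are continuous, and
point values are those of the continuous representative, so the space is given as a set of
continuous functions. -/
def LocalizedFrame.rangeSpace {d : ℕ}
    {V : Submodule ℂ (Lp ℂ 2 (volume : Measure (EuclideanSpace ℝ (Fin d))))}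
    (Φ : LocalizedFrame V) (p : ℝ≥0∞) : Set (EuclideanSpace ℝ (Fin d) → ℂ) :=
  {f | Continuous f ∧ MemLp f p volume ∧
    ∃ c : lp (fun _ : Φ.nodes => ℂ) p, LpSeriesConverges p (fun γ x => c γ * Φ.F γ x) f}

/-- `Λ` is a sampling set for the space `W` of functions in `L^p`: restriction to `Λ` maps `W` to
`ℓ^p(Λ)`, and `A ‖f‖_p ≤ ‖f|Λ‖_p ≤ B ‖f‖_p` for all `f ∈ W`. -/
def IsSamplingSet {d : ℕ} (W : Set (EuclideanSpace ℝ (Fin d) → ℂ)) (p : ℝ≥0∞)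
    (Λ : Set (EuclideanSpace ℝ (Fin d))) : Prop :=
  ∃ A B : ℝ, 0 < A ∧ 0 < B ∧ ∀ f ∈ W, ∃ a : lp (fun _ : Λ => ℂ) p,
    (∀ l : Λ, a l = f l) ∧
    A * (eLpNorm f p volume).toReal ≤ ‖a‖ ∧ ‖a‖ ≤ B * (eLpNorm f p volume).toReal

/-- `Λ` is an interpolating set for the space `W` of functions in `L^p`: every sequence in
`ℓ^p(Λ)` is the restriction to `Λ` of some `f ∈ W`. -/
def IsInterpolatingSet {d : ℕ} (W : Set (EuclideanSpace ℝ (Fin d) → ℂ)) (p : ℝ≥0∞)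
    (Λ : Set (EuclideanSpace ℝ (Fin d))) : Prop :=
  ∀ a : lp (fun _ : Λ => ℂ) p, ∃ f ∈ W, ∀ l : Λ, f l = a l

/-! Idea. Cut `ℝ^d` into small cubes indexed by `ℤ^d`. The amalgam condition makes the frame
functions dominated by `w (site x - site γ)` with `w` summable, so the evaluation matrix `(F_γ(λ))`
and all Gram matrices are convolution-dominated. By Schur's test such matrices act on every `ℓ^p` at
once; the work is to transfer lower bounds and surjectivity from one exponent to all others.

The engine is `enorm_le_tsum_of_isBoundedBelow`. Suppose `M` is convolution-dominated and bounded
below on finitely supported vectors of one `ℓ^p`. Localise a vector by tents of width `n`. The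
commutator of `M` with the tents becomes small as `n` grows, so the local `ℓ^p` norms satisfy `x ≤ b
+ u * x` with `u` of total mass below one, and a Neumann series solves this inequality. The outcome
is a pointwise bound of `c` by a summable kernel applied to `|M c|`, in which `p` no longer occurs;
it therefore serves all exponents. The kernel depends on `M` only through its envelope and its lower
bound.

This uniformity yields localised dual frames (`IsHilbertFrame.exists_localized_dual`). The Gram
matrix of a redundant frame is not bounded below, but after subtracting `z` with `|z| = A / 2` it
is, uniformly in `z`. This bounds the frame coefficients of the resolvent of the frame operator on
that circle, and the maximum modulus principle carries the bound to `z = 0`, that is, to the inverse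
frame operator. Localised dual frames give changes of frame that are bounded on all `ℓ^q`
(`exists_transition`).

Sampling says that the evaluation matrix is bounded below on the range of a convolution-dominated
projection `Q`. Stacking it with `1 - Q` gives a matrix that is bounded below on everything, to
which the engine applies (`exists_enorm_le_tsum_of_projection`).

Interpolation says that the evaluation matrix is onto. By the open mapping theorem and duality its
transpose is bounded below on the conjugate sequence space, hence on `ℓ^2`; so its rows form a frame
of `ℓ^2(Λ)`, and the localised dual frame is a convolution-dominated right inverse
(`exists_right_inverse`), bounded on every `ℓ^q`. -/

namespace ConvDom

/-! ### Convolution inequalities and Neumann series on a discrete group. -/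

section Conv

variable {G : Type*} [AddCommGroup G]

/-- Convolution of nonnegative functions on a discrete group. -/
noncomputable def conv (u v : G → ℝ≥0∞) (k : G) : ℝ≥0∞ := ∑' l, u (k - l) * v l

lemma tsum_sub_right (u : G → ℝ≥0∞) (l : G) : ∑' k, u (k - l) = ∑' k, u k :=
  (Equiv.subRight l).tsum_eq u

lemma tsum_sub_left (u : G → ℝ≥0∞) (l : G) : ∑' k, u (l - k) = ∑' k, u k :=
  (Equiv.subLeft l).tsum_eq u

lemma tsum_conv (u v : G → ℝ≥0∞) : ∑' k, conv u v k = (∑' k, u k) * ∑' k, v k := by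
  simp only [conv]
  rw [ENNReal.tsum_comm, ← ENNReal.tsum_mul_left]
  refine tsum_congr fun l => ?_
  rw [ENNReal.tsum_mul_right, tsum_sub_right]

lemma conv_assoc (u v b : G → ℝ≥0∞) : conv (conv u v) b = conv u (conv v b) := by
  funext k
  simp only [conv, ← ENNReal.tsum_mul_left, ← ENNReal.tsum_mul_right]
  rw [ENNReal.tsum_comm]
  rw [ENNReal.tsum_comm (f := fun m l => u (k - m) * (v (m - l) * b l))]
  rw [ENNReal.tsum_comm]
  refine tsum_congr fun l => ?_
  rw [← (Equiv.subRight l).tsum_eq]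
  refine tsum_congr fun m => ?_
  simp only [Equiv.subRight_apply]
  rw [mul_assoc]; congr 2; abel

lemma conv_mono_right {u b b' : G → ℝ≥0∞} (h : ∀ k, b k ≤ b' k) (k : G) :
    conv u b k ≤ conv u b' k :=
  ENNReal.tsum_le_tsum fun l => by gcongr; exact h l

lemma conv_add_right (u b b' : G → ℝ≥0∞) (k : G) :
    conv u (fun l => b l + b' l) k = conv u b k + conv u b' k := by
  simp only [conv, mul_add, ENNReal.tsum_add]

lemma conv_le_of_le {u b : G → ℝ≥0∞} {K : ℝ≥0∞} (h : ∀ k, b k ≤ K) (k : G) :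
    conv u b k ≤ (∑' l, u l) * K := by
  rw [← tsum_sub_left u k, ← ENNReal.tsum_mul_right]
  exact ENNReal.tsum_le_tsum fun l => by gcongr; exact h l

open Classical in
/-- Convolution powers. -/
noncomputable def convPow (u : G → ℝ≥0∞) : ℕ → G → ℝ≥0∞
  | 0 => fun k => if k = 0 then 1 else 0
  | n + 1 => conv (convPow u n) u

lemma conv_convPow_zero (u b : G → ℝ≥0∞) : conv (convPow u 0) b = b := by
  funext k
  rw [conv, tsum_eq_single k]
  · simp [convPow]
  · intro l hl
    simp [convPow, sub_eq_zero, hl.symm]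

lemma tsum_convPow (u : G → ℝ≥0∞) (n : ℕ) : ∑' k, convPow u n k = (∑' k, u k) ^ n := by
  induction n with
  | zero => simp [convPow]
  | succ n ih => rw [convPow, tsum_conv, ih, pow_succ]

/-- A bounded solution of `x ≤ b + u * x` is dominated by the Neumann series applied to `b`. -/
theorem le_conv_tsum_convPow {u b x : G → ℝ≥0∞} {K : ℝ≥0∞} (hu : ∑' k, u k < 1) (hK : K ≠ ∞)
    (hx : ∀ k, x k ≤ K) (h : ∀ k, x k ≤ b k + conv u x k) (k : G) :
    x k ≤ conv (fun l => ∑' n, convPow u n l) b k := by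
  -- Substituting the inequality into itself `N` times leaves a partial Neumann sum applied to `b`
  -- and a remainder.
  have key : ∀ N : ℕ, x k ≤ ∑ n ∈ Finset.range N, conv (convPow u n) b k
      + conv (convPow u N) x k := by
    intro N
    induction N with
    | zero => simp [conv_convPow_zero]
    | succ N ih =>
      refine ih.trans ?_
      rw [Finset.sum_range_succ, add_assoc]
      gcongr
      refine (conv_mono_right h k).trans ?_
      rw [conv_add_right, convPow, conv_assoc]
  have h2 : ∀ N : ℕ, ∑ n ∈ Finset.range N, conv (convPow u n) b k ≤
      conv (fun l => ∑' n, convPow u n l) b k := by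
    intro N
    simp only [conv, ← ENNReal.tsum_mul_right]
    rw [ENNReal.tsum_comm]
    exact ENNReal.sum_le_tsum _
  -- Boundedness of `x` enters only here: it makes the remainder geometrically small.
  have h3 : ∀ N : ℕ, x k ≤ conv (fun l => ∑' n, convPow u n l) b k + (∑' l, u l) ^ N * K := by
    intro N
    refine (key N).trans (add_le_add (h2 N) ?_)
    rw [← tsum_convPow]
    exact conv_le_of_le hx k
  have h4 : Tendsto (fun N : ℕ => conv (fun l => ∑' n, convPow u n l) b k + (∑' l, u l) ^ N * K)
      atTop (𝓝 (conv (fun l => ∑' n, convPow u n l) b k + 0 * K)) :=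
    tendsto_const_nhds.add (ENNReal.Tendsto.mul_const
      (ENNReal.tendsto_pow_atTop_nhds_zero_of_lt_one hu) (Or.inr hK))
  simpa using ge_of_tendsto' h4 h3

lemma tsum_tsum_convPow_lt_top {u : G → ℝ≥0∞} (hu : ∑' k, u k < 1) :
    ∑' l, ∑' n, convPow u n l < ∞ := by
  rw [ENNReal.tsum_comm]
  simp only [tsum_convPow, ENNReal.tsum_geometric]
  exact ENNReal.inv_lt_top.2 (tsub_pos_of_lt hu)

end Conv

/-! ### Schur's test and convolution-dominated kernels. -/

section Schur

variable {X Y : Type*} [MeasurableSpace X] [MeasurableSpace Y]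

/-- Schur's test. -/
theorem eLpNorm_lintegral_mul_le {μ : Measure X} {ν : Measure Y} [SFinite μ] [SFinite ν]
    {k : X → Y → ℝ≥0∞} (hk : Measurable (Function.uncurry k)) {K : ℝ≥0∞}
    (hK : K ≠ ∞) (hX : ∀ x, ∫⁻ y, k x y ∂ν ≤ K) (hY : ∀ y, ∫⁻ x, k x y ∂μ ≤ K)
    {g : Y → ℝ≥0∞} (hg : Measurable g) {p : ℝ≥0∞} (hp : 1 ≤ p) :
    eLpNorm (fun x => ∫⁻ y, k x y * g y ∂ν) p μ ≤ K * eLpNorm g p ν := by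
  have hkx : ∀ x, Measurable (k x) := fun x => hk.comp measurable_prodMk_left
  rcases eq_or_ne p ∞ with rfl | hpt
  · rw [eLpNorm_exponent_top, eLpNorm_exponent_top]
    refine eLpNormEssSup_le_of_ae_enorm_bound (Eventually.of_forall fun x => ?_)
    rw [enorm_eq_self]
    calc ∫⁻ y, k x y * g y ∂ν ≤ ∫⁻ y, k x y * eLpNormEssSup g ν ∂ν := by
          refine lintegral_mono_ae ?_
          filter_upwards [ae_le_eLpNormEssSup (f := g) (μ := ν)] with y hy
          gcongr
          simpa using hy
      _ = (∫⁻ y, k x y ∂ν) * eLpNormEssSup g ν := lintegral_mul_const _ (hkx x)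
      _ ≤ _ := by gcongr; exact hX x
  have hp0 : p ≠ 0 := (zero_lt_one.trans_le hp).ne'
  have hr0 : 0 < p.toReal := ENNReal.toReal_pos hp0 hpt
  have hr1 : 1 ≤ p.toReal := by
    rw [← ENNReal.toReal_one]; exact ENNReal.toReal_mono hpt hp
  set r := p.toReal with hr
  -- Hölder for the measure `k x y dν(y)`, whose total mass is at most `K`: its `L^1` norm is
  -- compared with its `L^r` norm.
  have h1 : ∀ x, (∫⁻ y, k x y * g y ∂ν) ^ r ≤ K ^ (r - 1) * ∫⁻ y, k x y * g y ^ r ∂ν := by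
    intro x
    have h := eLpNorm_le_eLpNorm_mul_rpow_measure_univ (μ := ν.withDensity (k x)) hp
      hg.aestronglyMeasurable
    rw [eLpNorm_one_eq_lintegral_enorm, eLpNorm_eq_lintegral_rpow_enorm_toReal hp0 hpt] at h
    simp only [enorm_eq_self] at h
    rw [lintegral_withDensity_eq_lintegral_mul _ (hkx x) hg,
      lintegral_withDensity_eq_lintegral_mul _ (hkx x) (hg.pow_const _),
      withDensity_apply _ MeasurableSet.univ, Measure.restrict_univ] at h
    simp only [Pi.mul_apply, ENNReal.toReal_one, div_one, ← hr] at h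
    calc (∫⁻ y, k x y * g y ∂ν) ^ r
        ≤ ((∫⁻ y, k x y * g y ^ r ∂ν) ^ (1 / r) * K ^ (1 - 1 / r)) ^ r := by
          gcongr
          refine h.trans ?_
          gcongr
          · rw [sub_nonneg, div_le_one hr0]; exact hr1
          · exact hX x
      _ = K ^ (r - 1) * ∫⁻ y, k x y * g y ^ r ∂ν := by
          rw [ENNReal.mul_rpow_of_nonneg _ _ hr0.le, ← ENNReal.rpow_mul, ← ENNReal.rpow_mul,
            mul_comm, one_div, inv_mul_cancel₀ hr0.ne', ENNReal.rpow_one]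
          congr 2
          field_simp
  rw [eLpNorm_eq_lintegral_rpow_enorm_toReal hp0 hpt,
    eLpNorm_eq_lintegral_rpow_enorm_toReal hp0 hpt]
  simp only [enorm_eq_self, ← hr]
  have hm : Measurable (Function.uncurry fun x y => k x y * g y ^ r) :=
    hk.mul ((hg.pow_const _).comp measurable_snd)
  calc (∫⁻ x, (∫⁻ y, k x y * g y ∂ν) ^ r ∂μ) ^ (1 / r)
      ≤ (∫⁻ x, K ^ (r - 1) * ∫⁻ y, k x y * g y ^ r ∂ν ∂μ) ^ (1 / r) := by
        gcongr with x; exact h1 x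
    _ = (K ^ (r - 1) * ∫⁻ y, ∫⁻ x, k x y * g y ^ r ∂μ ∂ν) ^ (1 / r) := by
        have hm' : Measurable fun x => ∫⁻ y, k x y * g y ^ r ∂ν := hm.lintegral_prod_right'
        rw [lintegral_const_mul _ hm', lintegral_lintegral_swap hm.aemeasurable]
    _ ≤ (K ^ (r - 1) * ∫⁻ y, K * g y ^ r ∂ν) ^ (1 / r) := by
        gcongr with y
        have hky : Measurable fun x => k x y := hk.comp measurable_prodMk_right
        rw [lintegral_mul_const _ hky]
        gcongr
        exact hY y
    _ = K * (∫⁻ y, g y ^ r ∂ν) ^ (1 / r) := by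
        rw [lintegral_const_mul _ (hg.pow_const _), ← mul_assoc,
          ENNReal.mul_rpow_of_nonneg _ _ (by positivity)]
        congr 1
        rcases eq_or_ne K 0 with rfl | hK0
        · simp [hr0]
        nth_rewrite 2 [← ENNReal.rpow_one K]
        rw [← ENNReal.rpow_add _ _ hK0 hK, ← ENNReal.rpow_mul]
        simp [hr0.ne']

/-- `π` places the points of a measure space at sites of a discrete group, so that each site
carries mass at most `N`. -/
structure IsSited {G : Type*} [MeasurableSpace G] (μ : Measure X) (π : X → G) (N : ℝ≥0∞) :
    Prop where
  measurable : Measurable π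
  ne_top : N ≠ ∞
  le : ∀ s, μ (π ⁻¹' {s}) ≤ N

lemma IsSited.mono {G : Type*} [MeasurableSpace G] {μ : Measure X} {π : X → G} {N N' : ℝ≥0∞}
    (h : IsSited μ π N) (hN : N ≤ N') (hN' : N' ≠ ∞) : IsSited μ π N' :=
  ⟨h.measurable, hN', fun s => (h.le s).trans hN⟩

lemma IsSited.lintegral_comp_le {G : Type*} [MeasurableSpace G] [Countable G]
    [MeasurableSingletonClass G] {μ : Measure X} {π : X → G} {N : ℝ≥0∞} (h : IsSited μ π N)
    (f : G → ℝ≥0∞) : ∫⁻ x, f (π x) ∂μ ≤ N * ∑' s, f s := by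
  rw [← lintegral_map (measurable_of_countable f) h.measurable, lintegral_countable',
    ← ENNReal.tsum_mul_left]
  refine ENNReal.tsum_le_tsum fun s => ?_
  rw [Measure.map_apply h.measurable (measurableSet_singleton s), mul_comm]
  gcongr
  exact h.le s

variable {G : Type*} [AddCommGroup G] [MeasurableSpace G] [Countable G] [MeasurableSingletonClass G]
  {μ : Measure X} {ν : Measure Y} {π : X → G} {ρ : Y → G} {N : ℝ≥0∞}

/-- Convolution-dominated kernels are bounded on `L^p`. -/
theorem eLpNorm_lintegral_conv_le [SFinite μ] [SFinite ν] (hμ : IsSited μ π N)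
    (hν : IsSited ν ρ N) {w : G → ℝ≥0∞} (hw : ∑' s, w s ≠ ∞)
    {g : Y → ℝ≥0∞} (hg : Measurable g) {p : ℝ≥0∞} (hp : 1 ≤ p) :
    eLpNorm (fun x => ∫⁻ y, w (π x - ρ y) * g y ∂ν) p μ ≤ N * (∑' s, w s) * eLpNorm g p ν := by
  refine eLpNorm_lintegral_mul_le (k := fun x y => w (π x - ρ y)) ?_
    (ENNReal.mul_ne_top hμ.ne_top hw) (fun x => ?_) (fun y => ?_) hg hp
  · have : Measurable fun q : G × G => w (q.1 - q.2) := measurable_of_countable _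
    exact this.comp ((hμ.measurable.comp measurable_fst).prodMk (hν.measurable.comp measurable_snd))
  · exact (hν.lintegral_comp_le fun s => w (π x - s)).trans_eq (by rw [tsum_sub_left])
  · exact (hμ.lintegral_comp_le fun s => w (s - ρ y)).trans_eq (by rw [tsum_sub_right])

/-- Collecting the intermediate variable site by site turns composition of kernels into convolution
of envelopes, at the cost of the mass `N` per site. -/
theorem lintegral_conv_le (hν : IsSited ν ρ N) (u v : G → ℝ≥0∞) (s t : G) :
    ∫⁻ y, u (s - ρ y) * v (ρ y - t) ∂ν ≤ N * conv u v (s - t) := by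
  refine (hν.lintegral_comp_le fun r => u (s - r) * v (r - t)).trans_eq ?_
  congr 1
  rw [conv, ← (Equiv.addRight t).tsum_eq]
  refine tsum_congr fun r => ?_
  simp only [Equiv.coe_addRight, add_sub_cancel_right]
  congr 2; abel

end Schur

/-! ### Tents on the lattice and the size of their commutators. -/

section Lattice

variable {d : ℕ}

/-- The index of the cube of side `n` that contains `s`. -/
def cell (n : ℕ) (s : Fin d → ℤ) : Fin d → ℤ := fun i => s i / n

lemma norm_natCast_smul (n : ℕ) (m : Fin d → ℤ) : ‖(n : ℤ) • m‖ = n * ‖m‖ := by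
  rw [norm_smul]; simp

lemma norm_sub_cell_le {n : ℕ} (hn : 0 < n) (s : Fin d → ℤ) :
    ‖s - (n : ℤ) • cell n s‖ ≤ n := by
  refine (pi_norm_le_iff_of_nonneg (by positivity)).2 fun i => ?_
  have hn' : (0 : ℤ) < n := by exact_mod_cast hn
  have h : (s - (n : ℤ) • cell n s) i = s i % n := by
    simp [cell, Int.emod_def]
  rw [h, Int.norm_eq_abs, abs_of_nonneg (by exact_mod_cast Int.emod_nonneg _ hn'.ne')]
  exact_mod_cast (Int.emod_lt_of_pos _ hn').le

lemma finite_norm_lt (r : ℝ) : {s : Fin d → ℤ | ‖s‖ < r}.Finite := by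
  refine ((isCompact_closedBall (0 : Fin d → ℤ) r).finite_of_discrete).subset fun s hs => ?_
  have hs' : ‖s‖ < r := hs
  simpa using hs'.le

/-- The indicator function of a ball of `ℤ^d` about the origin. -/
noncomputable def ballInd (r : ℝ) (s : Fin d → ℤ) : ℝ≥0∞ := if ‖s‖ < r then 1 else 0

lemma ballInd_le_of_imp {r r' : ℝ} {s s' : Fin d → ℤ} (h : ‖s‖ < r → ‖s'‖ < r') :
    ballInd r s ≤ ballInd r' s' := by
  unfold ballInd; split_ifs with h1 h2
  · exact le_rfl
  · exact absurd (h h1) h2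
  all_goals simp

lemma tsum_ballInd_ne_top (r : ℝ) : ∑' s : Fin d → ℤ, ballInd r s ≠ ∞ := by
  rw [tsum_eq_sum (s := (finite_norm_lt (d := d) r).toFinset)]
  · refine ENNReal.sum_ne_top.2 fun s _ => ?_
    unfold ballInd; split_ifs <;> simp
  · intro s hs
    simp only [Set.Finite.mem_toFinset, Set.mem_ofPred_eq] at hs
    simp [ballInd, hs]

/-- Replacing `s` by the corner of its cell costs at most `n`, so `3 n` becomes `4 n`, which
rescales to radius `4`. The count is thus uniform in `n` and `s`, and cannot spoil the smallness
gained from a large `n`. -/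
lemma tsum_ballInd_sub_smul_le {n : ℕ} (hn : 0 < n) (s : Fin d → ℤ) :
    ∑' m : Fin d → ℤ, ballInd (3 * n) (s - (n : ℤ) • m) ≤ ∑' m : Fin d → ℤ, ballInd 4 m := by
  rw [← (Equiv.addLeft (cell n s)).tsum_eq]
  refine ENNReal.tsum_le_tsum fun m => ballInd_le_of_imp fun h => ?_
  have hn' : (0 : ℝ) < n := by exact_mod_cast hn
  have h1 := norm_sub_cell_le hn s
  have h2 : (n : ℤ) • m = (s - (n : ℤ) • cell n s) - (s - (n : ℤ) • (cell n s + m)) := by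
    rw [smul_add]; abel
  have h3 : (n : ℝ) * ‖m‖ < n * 4 := by
    rw [← norm_natCast_smul, h2]
    refine (norm_sub_le _ _).trans_lt ?_
    simp only [Equiv.coe_addLeft] at h
    linarith
  exact lt_of_mul_lt_mul_left h3 hn'.le

/-- The tent of width `n` about the point `n k` of `ℤ^d`. -/
noncomputable def tent (n : ℕ) (k s : Fin d → ℤ) : ℝ := max 0 (min 1 (2 - ‖s - (n : ℤ) • k‖ / n))

lemma tent_nonneg (n : ℕ) (k s : Fin d → ℤ) : 0 ≤ tent n k s := le_max_left _ _

lemma tent_le_one (n : ℕ) (k s : Fin d → ℤ) : tent n k s ≤ 1 :=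
  max_le zero_le_one (min_le_left _ _)

lemma tent_cell {n : ℕ} (hn : 0 < n) (s : Fin d → ℤ) : tent n (cell n s) s = 1 := by
  have hn' : (0 : ℝ) < n := by exact_mod_cast hn
  have h : ‖s - (n : ℤ) • cell n s‖ / n ≤ 1 := (div_le_one hn').2 (norm_sub_cell_le hn s)
  rw [tent, min_eq_left (by linarith)]; simp

lemma norm_lt_of_tent_ne_zero {n : ℕ} (hn : 0 < n) {k s : Fin d → ℤ} (h : tent n k s ≠ 0) :
    ‖s - (n : ℤ) • k‖ < 2 * n := by
  have hn' : (0 : ℝ) < n := by exact_mod_cast hn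
  by_contra! h'
  refine h (max_eq_left ((min_le_right _ _).trans ?_))
  have := (le_div_iff₀ hn').2 h'
  linarith

lemma abs_tent_sub_le (n : ℕ) (k s t : Fin d → ℤ) :
    |tent n k s - tent n k t| ≤ min 1 (‖s - t‖ / n) := by
  refine le_min ?_ ?_
  · rw [abs_le]
    constructor <;> linarith [tent_nonneg n k s, tent_nonneg n k t, tent_le_one n k s,
      tent_le_one n k t]
  · calc |tent n k s - tent n k t|
        ≤ |min 1 (2 - ‖s - (n : ℤ) • k‖ / n) - min 1 (2 - ‖t - (n : ℤ) • k‖ / n)| := by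
          refine (abs_max_sub_max_le_max _ _ _ _).trans ?_
          simp
      _ ≤ |(2 - ‖s - (n : ℤ) • k‖ / n) - (2 - ‖t - (n : ℤ) • k‖ / n)| := by
          refine (abs_min_sub_min_le_max _ _ _ _).trans ?_
          simp
      _ = |‖t - (n : ℤ) • k‖ - ‖s - (n : ℤ) • k‖| / n := by
          rw [show 2 - ‖s - (n : ℤ) • k‖ / n - (2 - ‖t - (n : ℤ) • k‖ / n) =
            (‖t - (n : ℤ) • k‖ - ‖s - (n : ℤ) • k‖) / n by ring, abs_div, Nat.abs_cast]
      _ ≤ ‖s - t‖ / n := by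
          gcongr
          refine (abs_norm_sub_norm_le _ _).trans_eq ?_
          rw [norm_sub_rev]; congr 1; abel

/-- The envelope of a convolution-dominated matrix with the diagonal damped at scale `n`. -/
noncomputable def damp (w : (Fin d → ℤ) → ℝ≥0∞) (n : ℕ) (s : Fin d → ℤ) : ℝ≥0∞ :=
  w s * ENNReal.ofReal (min 1 (‖s‖ / n))

/-- Dominated convergence with majorant `w`. All smallness of the commutators comes from this limit.
-/
lemma tendsto_tsum_damp {w : (Fin d → ℤ) → ℝ≥0∞} (hw : ∑' s, w s ≠ ∞) :
    Tendsto (fun n : ℕ => ∑' s, damp w n s) atTop (𝓝 0) := by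
  simp_rw [← lintegral_count]
  have h0 : (0 : ℝ≥0∞) = ∫⁻ _ : Fin d → ℤ, 0 ∂Measure.count := by simp
  rw [h0]
  refine tendsto_lintegral_of_dominated_convergence w (fun n => measurable_of_countable _)
    (fun n => Eventually.of_forall fun s => ?_) (by rwa [lintegral_count])
    (Eventually.of_forall fun s => ?_)
  · refine mul_le_of_le_one_right' ?_
    rw [ENNReal.ofReal_le_one]; exact min_le_left _ _
  · have h1 : Tendsto (fun n : ℕ => min 1 (‖s‖ / n)) atTop (𝓝 (min 1 0)) :=
      tendsto_const_nhds.min (tendsto_const_div_atTop_nhds_zero_nat _)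
    have h2 := ENNReal.tendsto_ofReal h1
    have h3 := ENNReal.Tendsto.const_mul h2 (Or.inr (ENNReal.ne_top_of_tsum_ne_top hw s))
    simpa [damp] using h3

/-- The size of the block `(k, k - m)` of a commutator with a family of tents of width `n`. -/
noncomputable def commKernel (w : (Fin d → ℤ) → ℝ≥0∞) (n : ℕ) (m s : Fin d → ℤ) : ℝ≥0∞ :=
  damp w n s * (ballInd 4 m + ballInd (3 * n) (s - (n : ℤ) • m))

/-- For each displacement `s` the number of blocks it can contribute to is bounded independently of
`n`, so the total mass inherits the decay of the damped envelope. -/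
lemma tsum_commKernel_le (w : (Fin d → ℤ) → ℝ≥0∞) {n : ℕ} (hn : 0 < n) :
    ∑' m, ∑' s, commKernel w n m s ≤
      (∑' s, damp w n s) * (2 * ∑' m : Fin d → ℤ, ballInd 4 m) := by
  rw [ENNReal.tsum_comm, ← ENNReal.tsum_mul_right]
  refine ENNReal.tsum_le_tsum fun s => ?_
  simp only [commKernel]
  rw [ENNReal.tsum_mul_left, ENNReal.tsum_add, two_mul]
  exact mul_le_mul_right (add_le_add_right (tsum_ballInd_sub_smul_le hn s) _) _

/-- The left side is an entry of the commutator with the tent `k`. It vanishes unless `s` or `t`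
lies within `2 n` of `n k`. If `s` does, then `k` is within `3` cells of the cell of `s`; if only
`t` does, then `t - s` is within `3 n` of `n (k - cell n s)`. These are the two terms of the kernel.
Otherwise only the Lipschitz bound `1 / n` is used. The right side sees the cells only through their
difference, so a convolution over cells results. -/
lemma mul_tent_sub_le_commKernel {w : (Fin d → ℤ) → ℝ≥0∞} {n : ℕ} (hn : 0 < n)
    (k s t : Fin d → ℤ) :
    w (t - s) * ‖tent n k s - tent n k t‖ₑ ≤ commKernel w n (k - cell n s) (t - s) := by
  have hn' : (0 : ℝ) < n := by exact_mod_cast hn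
  by_cases h0 : tent n k s = 0 ∧ tent n k t = 0
  · simp [h0.1, h0.2]
  have h1 : w (t - s) * ‖tent n k s - tent n k t‖ₑ ≤ damp w n (t - s) := by
    unfold damp
    gcongr
    rw [Real.enorm_eq_ofReal_abs, ← norm_sub_rev]
    exact ENNReal.ofReal_le_ofReal (abs_tent_sub_le n k s t)
  refine h1.trans (le_mul_of_one_le_right' ?_)
  have hc := norm_sub_cell_le hn s
  by_cases hs : tent n k s = 0
  · have ht := norm_lt_of_tent_ne_zero hn fun h => h0 ⟨hs, h⟩
    refine le_add_left ?_
    rw [ballInd, if_pos]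
    have : t - s - (n : ℤ) • (k - cell n s) = (t - (n : ℤ) • k) - (s - (n : ℤ) • cell n s) := by
      rw [smul_sub]; abel
    rw [this]
    refine (norm_sub_le _ _).trans_lt ?_
    linarith
  · have ht := norm_lt_of_tent_ne_zero hn hs
    refine le_add_right ?_
    rw [ballInd, if_pos]
    have : (n : ℤ) • (k - cell n s) = (s - (n : ℤ) • cell n s) - (s - (n : ℤ) • k) := by
      rw [smul_sub]; abel
    have h3 : (n : ℝ) * ‖k - cell n s‖ < n * 4 := by
      rw [← norm_natCast_smul, this]
      refine (norm_sub_le _ _).trans_lt ?_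
      linarith
    exact lt_of_mul_lt_mul_left h3 hn'.le

end Lattice

lemma eLpNorm_count_le_tsum {I ε : Type*} [MeasurableSpace I] [MeasurableSingletonClass I]
    [TopologicalSpace ε] [ContinuousENorm ε] (f : I → ε) {p : ℝ≥0∞} (hp : 1 ≤ p) :
    eLpNorm f p .count ≤ ∑' i, ‖f i‖ₑ := by
  rcases eq_or_ne p ∞ with rfl | hpt
  · rw [eLpNorm_exponent_top, eLpNormEssSup_count]
    exact iSup_le fun i => ENNReal.le_tsum i
  have hp0 : p ≠ 0 := (zero_lt_one.trans_le hp).ne'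
  have hr0 : 0 < p.toReal := ENNReal.toReal_pos hp0 hpt
  have hr1 : 1 ≤ p.toReal := by
    rw [← ENNReal.toReal_one]; exact ENNReal.toReal_mono hpt hp
  rw [eLpNorm_eq_lintegral_rpow_enorm_toReal hp0 hpt, lintegral_count]
  set S := ∑' i, ‖f i‖ₑ
  rw [one_div, ENNReal.rpow_inv_le_iff hr0]
  have h : ∀ a : ℝ≥0∞, a ^ p.toReal = a * a ^ (p.toReal - 1) := fun a => by
    nth_rewrite 2 [← ENNReal.rpow_one a]
    rw [← ENNReal.rpow_add_of_nonneg _ _ zero_le_one (by linarith)]; simp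
  rw [h S, ← ENNReal.tsum_mul_right]
  refine ENNReal.tsum_le_tsum fun i => ?_
  rw [h]
  exact mul_le_mul_right (ENNReal.rpow_le_rpow (ENNReal.le_tsum i) (by linarith)) _

/-! ### Stability of convolution-dominated matrices across exponents. -/

section Stability

variable {d : ℕ} {I J : Type*} [MeasurableSpace I] [MeasurableSingletonClass I]
  {πI : I → Fin d → ℤ} {πJ : J → Fin d → ℤ}

/-- The matrix `M` is bounded below by `1 / C` on the finitely supported vectors of `ℓ^p`. -/
def IsBoundedBelow {I J : Type*} [MeasurableSpace I] [MeasurableSpace J] (M : J → I → ℂ)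
    (p C : ℝ≥0∞) : Prop :=
  ∀ (s : Finset I) (c : I → ℂ), (∀ i ∉ s, c i = 0) →
    eLpNorm c p .count ≤ C * eLpNorm (fun j => ∑ i ∈ s, M j i * c i) p .count

/-- Moving the tent past `M` leaves the commutator, which is then split according to the cell `l`
that contains the column index. -/
lemma enorm_sum_tent_mul_le {w : (Fin d → ℤ) → ℝ≥0∞} {M : J → I → ℂ}
    (hM : ∀ j i, ‖M j i‖ₑ ≤ w (πJ j - πI i)) {n : ℕ} (hn : 0 < n) (s : Finset I) (c : I → ℂ)
    (k : Fin d → ℤ) (j : J) :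
    ‖∑ i ∈ s, M j i * (tent n k (πI i) * c i)‖ₑ ≤
      ‖tent n k (πJ j) * ∑ i ∈ s, M j i * c i‖ₑ +
      ∑ l ∈ s.image fun i => cell n (πI i), ∫⁻ i, commKernel w n (k - l) (πJ j - πI i) *
        (if cell n (πI i) = l then ‖c i‖ₑ else 0) ∂.count := by
  classical
  have h1 : ∑ i ∈ s, M j i * (tent n k (πI i) * c i) =
      tent n k (πJ j) * ∑ i ∈ s, M j i * c i +
      ∑ i ∈ s, M j i * (((tent n k (πI i) - tent n k (πJ j) : ℝ) : ℂ) * c i) := by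
    rw [Finset.mul_sum, ← Finset.sum_add_distrib]
    refine Finset.sum_congr rfl fun i _ => ?_
    push_cast; ring
  rw [h1]
  refine (enorm_add_le _ _).trans ?_
  gcongr
  refine (enorm_sum_le _ _).trans ?_
  rw [← Finset.sum_fiberwise_of_maps_to (g := fun i => cell n (πI i))
    (t := s.image fun i => cell n (πI i)) (fun i hi => Finset.mem_image_of_mem _ hi)]
  refine Finset.sum_le_sum fun l _ => ?_
  rw [lintegral_count]
  refine le_trans ?_ (ENNReal.sum_le_tsum (s.filter fun i => cell n (πI i) = l))
  refine Finset.sum_le_sum fun i hi => ?_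
  rw [if_pos (Finset.mem_filter.1 hi).2, enorm_mul, enorm_mul, ← mul_assoc,
    ← (Finset.mem_filter.1 hi).2]
  gcongr
  refine le_trans ?_ (mul_tent_sub_le_commKernel hn _ _ _)
  have : ‖((tent n k (πI i) - tent n k (πJ j) : ℝ) : ℂ)‖ₑ =
    ‖tent n k (πI i) - tent n k (πJ j)‖ₑ := by
    simp [← ofReal_norm, -Complex.ofReal_sub]
  rw [this]
  gcongr
  exact hM j i

variable [Countable I] [MeasurableSpace J] [MeasurableSingletonClass J] [Countable J] {N : ℝ≥0∞}

/-- The lower bound is applied to `c` multiplied by a tent, and each commutator block is estimated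
by Schur's test. Since the tent of a cell equals one on that cell, the part of `c` in the cell `l`
is again dominated by a local norm; this closes the inequality `x ≤ b + u * x` for the local norms.
-/
lemma eLpNorm_tent_mul_le {w : (Fin d → ℤ) → ℝ≥0∞} (hw : ∑' s, w s ≠ ∞)
    (hI : IsSited .count πI N) (hJ : IsSited .count πJ N) {M : J → I → ℂ}
    (hM : ∀ j i, ‖M j i‖ₑ ≤ w (πJ j - πI i)) {p C : ℝ≥0∞} (hp : 1 ≤ p)
    (hbb : IsBoundedBelow M p C) {n : ℕ} (hn : 0 < n) (s : Finset I) (c : I → ℂ)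
    (hc : ∀ i ∉ s, c i = 0) (k : Fin d → ℤ) :
    eLpNorm (fun i => (tent n k (πI i) : ℂ) * c i) p .count ≤
      C * eLpNorm (fun j => (tent n k (πJ j) : ℂ) * ∑ i ∈ s, M j i * c i) p .count +
      conv (fun m => C * (N * ∑' s, commKernel w n m s))
        (fun l => eLpNorm (fun i => (tent n l (πI i) : ℂ) * c i) p .count) k := by
  classical
  have hfin : ∀ m, ∑' s, commKernel w n m s ≠ ∞ := fun m => by
    refine ne_top_of_le_ne_top ?_ (ENNReal.le_tsum (f := fun m => ∑' s, commKernel w n m s) m)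
    refine ne_top_of_le_ne_top ?_ (tsum_commKernel_le w hn)
    refine ENNReal.mul_ne_top ?_ (ENNReal.mul_ne_top (by simp) (tsum_ballInd_ne_top 4))
    refine ne_top_of_le_ne_top hw (ENNReal.tsum_le_tsum fun s => mul_le_of_le_one_right' ?_)
    rw [ENNReal.ofReal_le_one]; exact min_le_left _ _
  set L := s.image fun i => cell n (πI i)
  set T : (Fin d → ℤ) → J → ℝ≥0∞ := fun l j => ∫⁻ i, commKernel w n (k - l) (πJ j - πI i) *
        (if cell n (πI i) = l then ‖c i‖ₑ else 0) ∂.count with hT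
  set A : J → ℝ≥0∞ := fun j => ‖(tent n k (πJ j) : ℂ) * ∑ i ∈ s, M j i * c i‖ₑ with hA
  have hm : ∀ f : J → ℝ≥0∞, AEStronglyMeasurable f .count := fun f =>
    (measurable_of_countable f).aestronglyMeasurable
  have h1 := hbb s (fun i => tent n k (πI i) * c i) (fun i hi => by simp [hc i hi])
  have h2 : eLpNorm (fun j => ∑ i ∈ s, M j i * (tent n k (πI i) * c i)) p .count ≤
      eLpNorm A p .count + ∑ l ∈ L, eLpNorm (T l) p .count := by
    refine (eLpNorm_mono_enorm (g := A + ∑ l ∈ L, T l) fun j => ?_).trans ?_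
    · rw [enorm_eq_self]
      rw [Pi.add_apply, Finset.sum_apply]
      exact enorm_sum_tent_mul_le hM hn s c k j
    · refine (eLpNorm_add_le (hm _) (hm _) hp).trans ?_
      gcongr
      exact eLpNorm_sum_le (fun l _ => hm _) hp
  have h3 : ∀ l, eLpNorm (T l) p .count ≤ N * (∑' s, commKernel w n (k - l) s) *
      eLpNorm (fun i => (tent n l (πI i) : ℂ) * c i) p .count := fun l => by
    refine (eLpNorm_lintegral_conv_le hJ hI (hfin _) (measurable_of_countable _) hp).trans ?_
    gcongr
    refine eLpNorm_mono_enorm fun i => ?_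
    rw [enorm_eq_self]
    split_ifs with h
    · rw [← h, tent_cell hn]; simp
    · simp
  calc _ ≤ C * (eLpNorm A p .count + ∑ l ∈ L, eLpNorm (T l) p .count) := h1.trans (by gcongr)
    _ ≤ _ := by
      rw [mul_add, hA]
      gcongr
      · exact (eLpNorm_enorm _).le
      · rw [Finset.mul_sum]
        refine le_trans (Finset.sum_le_sum fun l _ => ?_) (ENNReal.sum_le_tsum L)
        rw [mul_assoc]
        gcongr
        exact h3 l

/-- The width `n` is chosen from `w`, `N` and `C` before the matrix appears, so one kernel works for
a whole family of matrices. -/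
lemma enorm_le_tsum_of_isBoundedBelow_finset {w : (Fin d → ℤ) → ℝ≥0∞} (hw : ∑' s, w s ≠ ∞)
    (hI : IsSited .count πI N) (hJ : IsSited .count πJ N) {p C : ℝ≥0∞} (hp : 1 ≤ p) (hC : C ≠ ∞) :
    ∃ w' : (Fin d → ℤ) → ℝ≥0∞, ∑' s, w' s ≠ ∞ ∧ ∀ M : J → I → ℂ,
      (∀ j i, ‖M j i‖ₑ ≤ w (πJ j - πI i)) → IsBoundedBelow M p C →
      ∀ (s : Finset I) (c : I → ℂ), (∀ i ∉ s, c i = 0) → ∀ i,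
        ‖c i‖ₑ ≤ ∑' j, w' (πI i - πJ j) * ‖∑ i ∈ s, M j i * c i‖ₑ := by
  have hp0 : p ≠ 0 := (zero_lt_one.trans_le hp).ne'
  obtain ⟨n, hn, hlt⟩ : ∃ n : ℕ, 0 < n ∧
      C * (N * ((∑' s, damp w n s) * (2 * ∑' m : Fin d → ℤ, ballInd 4 m))) < 1 := by
    have h1 : Tendsto (fun n : ℕ =>
        C * (N * ((∑' s, damp w n s) * (2 * ∑' m : Fin d → ℤ, ballInd 4 m)))) atTop (𝓝 0) := by
      have h2 := ENNReal.Tendsto.mul_const (b := 2 * ∑' m : Fin d → ℤ, ballInd 4 m)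
        (tendsto_tsum_damp hw) (Or.inr (ENNReal.mul_ne_top (by simp) (tsum_ballInd_ne_top 4)))
      have h3 := ENNReal.Tendsto.const_mul (ENNReal.Tendsto.const_mul h2 (Or.inr hI.ne_top))
        (Or.inr hC)
      simpa using h3
    exact ((eventually_gt_atTop 0).and (h1.eventually_lt_const one_pos)).exists
  set u : (Fin d → ℤ) → ℝ≥0∞ := fun m => C * (N * ∑' s, commKernel w n m s) with hu
  have hu1 : ∑' m, u m < 1 := by
    refine lt_of_le_of_lt ?_ hlt
    rw [hu, ENNReal.tsum_mul_left, ENNReal.tsum_mul_left]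
    gcongr
    exact tsum_commKernel_le w hn
  set R : (Fin d → ℤ) → ℝ≥0∞ := fun l => ∑' n, convPow u n l with hR
  -- The radius `3 n` is the tent radius `2 n` plus the distance, at most `n`, from a point to the
  -- corner of its cell.
  refine ⟨fun t => C * ∑' m, R m * ballInd (3 * n) (t - (n : ℤ) • m), ?_, ?_⟩
  · rw [ENNReal.tsum_mul_left, ENNReal.tsum_comm]
    refine ENNReal.mul_ne_top hC ?_
    simp_rw [ENNReal.tsum_mul_left, tsum_sub_right]
    rw [ENNReal.tsum_mul_right]
    exact ENNReal.mul_ne_top (tsum_tsum_convPow_lt_top hu1).ne (tsum_ballInd_ne_top _)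
  intro M hM hbb s c hc i
  set x : (Fin d → ℤ) → ℝ≥0∞ := fun l => eLpNorm (fun i => (tent n l (πI i) : ℂ) * c i) p .count
  have htent : ∀ l t : Fin d → ℤ, ‖(tent n l t : ℂ)‖ₑ ≤ 1 := fun l t => by
    rw [← ofReal_norm, Complex.norm_real, Real.norm_of_nonneg (tent_nonneg _ _ _)]
    exact ENNReal.ofReal_le_one.2 (tent_le_one _ _ _)
  have hK : ∑' i, ‖c i‖ₑ ≠ ∞ := by
    rw [tsum_eq_sum (s := s) (fun i hi => by simp [hc i hi])]
    exact ENNReal.sum_ne_top.2 fun i _ => by simp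
  have hx : ∀ l, x l ≤ ∑' i, ‖c i‖ₑ := fun l => by
    refine (eLpNorm_mono_enorm (g := c) fun i => ?_).trans (eLpNorm_count_le_tsum c hp)
    rw [enorm_mul]
    exact mul_le_of_le_one_left' (htent _ _)
  have h1 := le_conv_tsum_convPow hu1 hK hx
    (eLpNorm_tent_mul_le hw hI hJ hM hp hbb hn s c hc) (cell n (πI i))
  have h2 : ‖c i‖ₑ ≤ x (cell n (πI i)) := by
    have := enorm_le_eLpNorm_count (fun i' => (tent n (cell n (πI i)) (πI i') : ℂ) * c i') i hp0
    simpa [tent_cell hn] using this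
  refine (h2.trans h1).trans ?_
  -- The exponent disappears here: the local data are bounded in `ℓ^1`, just as `h2` bounds a single
  -- entry of `c` by a local norm.
  have h3 : ∀ k, eLpNorm (fun j => (tent n k (πJ j) : ℂ) * ∑ i ∈ s, M j i * c i) p .count ≤
      ∑' j, ballInd (2 * n) (πJ j - (n : ℤ) • k) * ‖∑ i ∈ s, M j i * c i‖ₑ := fun k => by
    refine (eLpNorm_count_le_tsum _ hp).trans (ENNReal.tsum_le_tsum fun j => ?_)
    rw [enorm_mul]
    gcongr
    by_cases h : tent n k (πJ j) = 0
    · simp [h]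
    · rw [ballInd, if_pos (norm_lt_of_tent_ne_zero hn h)]
      exact htent _ _
  calc conv R (fun k => C * eLpNorm (fun j =>
          (tent n k (πJ j) : ℂ) * ∑ i ∈ s, M j i * c i) p .count) (cell n (πI i))
      ≤ ∑' k, R (cell n (πI i) - k) * (C * ∑' j, ballInd (2 * n) (πJ j - (n : ℤ) • k) *
          ‖∑ i ∈ s, M j i * c i‖ₑ) := 
        ENNReal.tsum_le_tsum fun k => mul_le_mul_right (mul_le_mul_right (h3 k) C) _
    _ = ∑' j, (C * ∑' k, R (cell n (πI i) - k) * ballInd (2 * n) (πJ j - (n : ℤ) • k)) *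
          ‖∑ i ∈ s, M j i * c i‖ₑ := by
        simp_rw [← ENNReal.tsum_mul_left, ← ENNReal.tsum_mul_right]
        rw [ENNReal.tsum_comm]
        refine tsum_congr fun j => tsum_congr fun k => by ring
    _ ≤ _ := by
        refine ENNReal.tsum_le_tsum fun j => ?_
        gcongr
        rw [← (Equiv.subLeft (cell n (πI i))).tsum_eq]
        refine mul_le_mul_right (ENNReal.tsum_le_tsum fun m => ?_) C
        simp only [Equiv.subLeft_apply, sub_sub_cancel]
        gcongr
        refine ballInd_le_of_imp fun h => ?_
        have h4 : πI i - πJ j - (n : ℤ) • m = (πI i - (n : ℤ) • cell n (πI i)) -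
            (πJ j - (n : ℤ) • (cell n (πI i) - m)) := by
          rw [smul_sub]; abel
        rw [h4]
        refine (norm_sub_le _ _).trans_lt ?_
        have := norm_sub_cell_le hn (πI i)
        linarith

/-- Stability of convolution-dominated matrices: a lower bound on the finitely supported vectors of
one space `ℓ^p` gives a pointwise reconstruction estimate for all bounded vectors, by means of a
convolution-dominated kernel that depends on the matrix only through its envelope and the bound. -/
theorem enorm_le_tsum_of_isBoundedBelow {w : (Fin d → ℤ) → ℝ≥0∞} (hw : ∑' s, w s ≠ ∞)
    (hI : IsSited .count πI N) (hJ : IsSited .count πJ N) {p C : ℝ≥0∞} (hp : 1 ≤ p) (hC : C ≠ ∞) :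
    ∃ w' : (Fin d → ℤ) → ℝ≥0∞, ∑' s, w' s ≠ ∞ ∧ ∀ M : J → I → ℂ,
      (∀ j i, ‖M j i‖ₑ ≤ w (πJ j - πI i)) → IsBoundedBelow M p C →
      ∀ (c : I → ℂ) (K : ℝ≥0∞), K ≠ ∞ → (∀ i, ‖c i‖ₑ ≤ K) → ∀ i,
        ‖c i‖ₑ ≤ ∑' j, w' (πI i - πJ j) * ‖∑' i, M j i * c i‖ₑ := by
  classical
  obtain ⟨w', hw', H⟩ := enorm_le_tsum_of_isBoundedBelow_finset hw hI hJ hp hC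
  refine ⟨w', hw', fun M hM hbb c K hK hcK i => ?_⟩
  have hrow : ∀ j, ∑' i, w (πJ j - πI i) ≤ N * ∑' s, w s := fun j => by
    rw [← lintegral_count, ← tsum_sub_left w (πJ j)]
    exact hI.lintegral_comp_le fun s => w (πJ j - s)
  have hsum : ∀ j, Summable fun i => M j i * c i := fun j => by
    refine Summable.of_enorm (ne_top_of_le_ne_top
      (ENNReal.mul_ne_top (ENNReal.mul_ne_top hI.ne_top hw) hK)
      (le_trans ?_ (mul_le_mul_left (hrow j) K)))
    rw [← ENNReal.tsum_mul_right]
    refine ENNReal.tsum_le_tsum fun i => ?_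
    rw [enorm_mul]
    exact mul_le_mul' (hM j i) (hcK i)
  have hcomp : ∀ i', ∑' j, w' (πI i - πJ j) * w (πJ j - πI i') ≤
      N * conv w' w (πI i - πI i') := fun i' => by
    rw [← lintegral_count]
    exact lintegral_conv_le hJ w' w _ _
  -- Truncations of a bounded vector need not converge in norm. The pointwise error of truncation is
  -- instead bounded by a tail of this convergent series, because the composed kernel is summable.
  have htail : ∑' i', N * conv w' w (πI i - πI i') * K ≠ ∞ := by
    rw [ENNReal.tsum_mul_right, ENNReal.tsum_mul_left]
    refine ENNReal.mul_ne_top (ENNReal.mul_ne_top hI.ne_top ?_) hK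
    rw [← lintegral_count]
    refine ne_top_of_le_ne_top ?_ (hI.lintegral_comp_le fun s => conv w' w (πI i - s))
    rw [tsum_sub_left, tsum_conv]
    exact ENNReal.mul_ne_top hI.ne_top (ENNReal.mul_ne_top hw' hw)
  have key : ∀ s : Finset I, i ∈ s → ‖c i‖ₑ ≤ ∑' j, w' (πI i - πJ j) * ‖∑' i, M j i * c i‖ₑ +
      ∑' i' : {x // x ∉ s}, N * conv w' w (πI i - πI i') * K := by
    intro s his
    have h1 := H M hM hbb s (fun i => if i ∈ s then c i else 0) (fun i hi => by simp [hi]) i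
    rw [if_pos his] at h1
    refine h1.trans ?_
    calc _ ≤ ∑' j, (w' (πI i - πJ j) * ‖∑' i, M j i * c i‖ₑ +
          w' (πI i - πJ j) * ∑' i' : {x // x ∉ s}, w (πJ j - πI i') * K) := by
          refine ENNReal.tsum_le_tsum fun j => ?_
          rw [← mul_add]
          gcongr
          have h2 : ∑ i ∈ s, M j i * (if i ∈ s then c i else 0) =
              ∑' i, M j i * c i - ∑' i' : {x // x ∉ s}, M j i' * c i' := by
            rw [← (hsum j).sum_add_tsum_subtype_compl s, add_sub_cancel_right]
            exact Finset.sum_congr rfl fun i hi => by simp [hi]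
          rw [h2]
          refine (enorm_sub_le).trans ?_
          gcongr
          refine enorm_tsum_le_tsum_enorm.trans (ENNReal.tsum_le_tsum fun i' => ?_)
          rw [enorm_mul]
          exact mul_le_mul' (hM j i') (hcK i')
      _ ≤ _ := by
          rw [ENNReal.tsum_add]
          gcongr
          simp_rw [← ENNReal.tsum_mul_left]
          rw [ENNReal.tsum_comm]
          refine ENNReal.tsum_le_tsum fun i' => ?_
          simp_rw [← mul_assoc]
          rw [ENNReal.tsum_mul_right]
          gcongr
          exact hcomp i'
  have h5 := (ENNReal.tendsto_tsum_compl_atTop_zero htail).const_add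
    (∑' j, w' (πI i - πJ j) * ‖∑' i, M j i * c i‖ₑ)
  rw [add_zero] at h5
  exact ge_of_tendsto h5 ((eventually_ge_atTop {i}).mono fun s hs =>
    key s (Finset.singleton_subset_iff.1 hs))

end Stability

/-! ### Discretisation of `ℝ^d` by small cubes. -/

section Sites

variable {d : ℕ}

/-- The number of cubes per unit length in the subdivision of `ℝ^d` that defines `site`. -/
noncomputable def mesh (d : ℕ) : ℝ := 8 * (d + 1)

lemma mesh_pos (d : ℕ) : 0 < mesh d := by unfold mesh; positivity

/-- The index of the cube of side `1 / mesh d` that contains a point of `ℝ^d`. -/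
noncomputable def site (x : EuclideanSpace ℝ (Fin d)) : Fin d → ℤ := fun i => ⌊mesh d * x i⌋

lemma measurable_site : Measurable (site (d := d)) := by
  refine measurable_pi_lambda _ fun i => Int.measurable_floor.comp ?_
  fun_prop

/-- The value of `mesh` is chosen for this: `d` coordinates of size at most `2 / mesh d` have sum at
most `1 / 4`. -/
lemma norm_le_of_abs_lt {x : EuclideanSpace ℝ (Fin d)} (h : ∀ i, |mesh d * x i| < 2) :
    ‖x‖ ≤ 1 / 4 := by
  have hm := mesh_pos d
  have h1 : ‖x‖ ≤ ∑ i : Fin d, |x i| := by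
    rw [EuclideanSpace.norm_eq]
    refine Real.sqrt_le_iff.2 ⟨Finset.sum_nonneg fun i _ => abs_nonneg _, ?_⟩
    simpa using Finset.sum_sq_le_sq_sum_of_nonneg (s := Finset.univ) (f := fun i => |x i|)
      fun i _ => abs_nonneg _
  have h2 : ∀ i, |x i| ≤ 2 / mesh d := fun i => by
    rw [le_div_iff₀ hm, mul_comm]
    have := h i
    rw [abs_mul, abs_of_pos hm] at this
    exact this.le
  refine h1.trans ((Finset.sum_le_sum fun i _ => h2 i).trans ?_)
  simp only [Finset.sum_const, Finset.card_univ, Fintype.card_fin, nsmul_eq_mul, mesh]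
  rw [mul_div_assoc', div_le_div_iff₀ (by positivity) (by norm_num)]
  linarith

/-- In each coordinate the integer parts cancel and three fractional parts remain, one with a plus
and two with a minus sign, so the error is below `2`. -/
lemma norm_sub_sub_le_of_site {x y z : EuclideanSpace ℝ (Fin d)} (h : site z = site x - site y) :
    ‖x - y - z‖ ≤ 1 / 4 := by
  refine norm_le_of_abs_lt fun i => ?_
  have hi : ⌊mesh d * z i⌋ = ⌊mesh d * x i⌋ - ⌊mesh d * y i⌋ := congrFun h i
  have hi' : (⌊mesh d * z i⌋ : ℝ) = ⌊mesh d * x i⌋ - ⌊mesh d * y i⌋ := by exact_mod_cast hi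
  have hx1 := Int.floor_le (mesh d * x i)
  have hx2 := Int.lt_floor_add_one (mesh d * x i)
  have hy1 := Int.floor_le (mesh d * y i)
  have hy2 := Int.lt_floor_add_one (mesh d * y i)
  have hz1 := Int.floor_le (mesh d * z i)
  have hz2 := Int.lt_floor_add_one (mesh d * z i)
  simp only [PiLp.sub_apply, mul_sub, abs_lt]
  constructor <;> linarith

lemma norm_sub_le_of_site_eq {x y : EuclideanSpace ℝ (Fin d)} (h : site x = site y) :
    ‖x - y‖ ≤ 1 / 4 := by
  refine norm_le_of_abs_lt fun i => ?_
  have hi : ⌊mesh d * x i⌋ = ⌊mesh d * y i⌋ := congrFun h i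
  have h1 := Int.abs_sub_lt_one_of_floor_eq_floor hi
  simp only [PiLp.sub_apply, mul_sub]
  linarith

/-- The volume of a cube of the subdivision. -/
noncomputable def cubeVol (d : ℕ) : ℝ≥0∞ :=
  volume (site (d := d) ⁻¹' {0})

lemma volume_site_preimage (s : Fin d → ℤ) :
    volume (site (d := d) ⁻¹' {s}) = cubeVol d := by
  have hm := (mesh_pos d).ne'
  have : site (d := d) ⁻¹' {s} =
      (fun x => x - WithLp.toLp 2 fun i => (s i : ℝ) / mesh d) ⁻¹' (site (d := d) ⁻¹' {0}) := by
    ext x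
    simp only [Set.mem_preimage, Set.mem_singleton_iff, funext_iff, site, PiLp.sub_apply, mul_sub,
      mul_div_cancel₀ _ hm, Int.floor_sub_intCast, Pi.zero_apply, sub_eq_zero]
  rw [this]
  simp_rw [sub_eq_add_neg]
  rw [measure_preimage_add_right, cubeVol]

lemma cubeVol_ne_zero : cubeVol d ≠ 0 := by
  have hm := mesh_pos d
  have hopen : IsOpen {x : EuclideanSpace ℝ (Fin d) | ∀ i, 0 < mesh d * x i ∧ mesh d * x i < 1} := by
    simp only [Set.ofPred_forall]
    refine isOpen_iInter_of_finite fun i => ?_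
    have hc : Continuous fun x : EuclideanSpace ℝ (Fin d) => mesh d * x i := by fun_prop
    exact (isOpen_lt continuous_const hc).inter (isOpen_lt hc continuous_const)
  have hne : {x : EuclideanSpace ℝ (Fin d) | ∀ i, 0 < mesh d * x i ∧ mesh d * x i < 1}.Nonempty := by
    refine ⟨WithLp.toLp 2 fun _ => 1 / (2 * mesh d), fun i => ?_⟩
    have : mesh d * (1 / (2 * mesh d)) = 1 / 2 := by field_simp
    simp only [this]
    norm_num
  refine ((hopen.measure_pos volume hne).trans_le (measure_mono fun x hx => ?_)).ne'
  simp only [Set.mem_preimage, Set.mem_singleton_iff, funext_iff, site, Pi.zero_apply,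
    Int.floor_eq_zero_iff]
  exact fun i => ⟨(hx i).1.le, (hx i).2⟩

lemma site_preimage_subset_ball {s : Fin d → ℤ} {x : EuclideanSpace ℝ (Fin d)} (hx : site x = s) :
    site (d := d) ⁻¹' {s} ⊆ ball x 1 := by
  intro y hy
  rw [mem_ball, dist_eq_norm]
  have : site y = site x := by rw [hx]; exact hy
  linarith [norm_sub_le_of_site_eq this]

lemma cubeVol_ne_top : cubeVol d ≠ ∞ := by
  have h : site (0 : EuclideanSpace ℝ (Fin d)) = 0 := by ext i; simp [site]
  exact ne_top_of_le_ne_top measure_ball_lt_top.ne (measure_mono (site_preimage_subset_ball h))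

lemma isSited_volume : IsSited volume (site (d := d)) (cubeVol d) :=
  ⟨measurable_site, cubeVol_ne_top, fun s => (volume_site_preimage s).le⟩

end Sites

/-! ### Relatively separated sets have boundedly many points per cube. -/

section RelSep

variable {d : ℕ} {Λ : Set (EuclideanSpace ℝ (Fin d))}

lemma encard_site_le {N : ℕ} (hN : ∀ x : EuclideanSpace ℝ (Fin d), (Λ ∩ ball x 1).encard ≤ N)
    (s : Fin d → ℤ) : (Λ ∩ site (d := d) ⁻¹' {s}).encard ≤ N := by
  rcases (site (d := d) ⁻¹' {s}).eq_empty_or_nonempty with h | ⟨x, hx⟩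
  · simp [h]
  · exact (Set.encard_le_encard (Set.inter_subset_inter_right _
      (site_preimage_subset_ball hx))).trans (hN x)

lemma _root_.RelativelySeparated.countable (h : RelativelySeparated Λ) : Countable Λ := by
  obtain ⟨N, hN⟩ := h
  have h1 : Λ = ⋃ s : Fin d → ℤ, Λ ∩ site (d := d) ⁻¹' {s} := by
    ext x; simp
  rw [Set.countable_coe_iff, h1]
  refine Set.countable_iUnion fun s => Set.Finite.countable ?_
  exact Set.finite_of_encard_le_coe (encard_site_le hN s)

lemma _root_.RelativelySeparated.exists_isSited (h : RelativelySeparated Λ) :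
    ∃ N : ℝ≥0∞, IsSited .count (fun l : Λ => site (l : EuclideanSpace ℝ (Fin d))) N := by
  have hc := h.countable
  obtain ⟨N, hN⟩ := h
  refine ⟨N, measurable_of_countable _, by simp, fun s => ?_⟩
  rw [Measure.count_apply (Set.to_countable _).measurableSet]
  have h1 := encard_site_le hN s
  have h2 : ((fun l : Λ => site (l : EuclideanSpace ℝ (Fin d))) ⁻¹' {s}).encard =
      (Λ ∩ site (d := d) ⁻¹' {s}).encard := by
    rw [← Subtype.val_injective.encard_image]
    congr 1
    ext x; simp [and_comm]
  rw [← h2] at h1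
  exact_mod_cast h1

end RelSep

/-! ### A summable envelope on the lattice from the amalgam norm. -/

section Envelope

variable {d : ℕ}

/-- The discretised envelope of a function in the amalgam space. -/
noncomputable def siteEnvelope (Θ : EuclideanSpace ℝ (Fin d) → ℝ) (s : Fin d → ℤ) : ℝ≥0∞ :=
  ⨅ z ∈ site (d := d) ⁻¹' {s}, eLpNorm Θ ∞ (volume.restrict (ball z 1))

/-- Taking an infimum over each cube makes the sum, times the volume of a cube, a lower sum of the
amalgam integral. -/
lemma tsum_siteEnvelope_ne_top {Θ : EuclideanSpace ℝ (Fin d) → ℝ} (hΘ : MemAmalgam Θ) :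
    ∑' s, siteEnvelope Θ s ≠ ∞ := by
  have h1 : (∑' s, siteEnvelope Θ s) * cubeVol d ≤
      ∫⁻ x, eLpNorm Θ ∞ (volume.restrict (ball x 1)) := by
    have hU : (Set.univ : Set (EuclideanSpace ℝ (Fin d))) = ⋃ s, site (d := d) ⁻¹' {s} := by
      ext x; simp
    rw [← setLIntegral_univ, hU, lintegral_iUnion
      (fun s => measurable_site (measurableSet_singleton s))
      (fun s t hst => Disjoint.preimage _ (by simpa using hst)), ← ENNReal.tsum_mul_right]
    refine ENNReal.tsum_le_tsum fun s => ?_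
    rw [← volume_site_preimage s, ← setLIntegral_const]
    refine setLIntegral_mono' (measurable_site (measurableSet_singleton s)) fun x hx => ?_
    exact iInf₂_le x hx
  intro h
  rw [h, ENNReal.top_mul cubeVol_ne_zero] at h1
  exact (h1.trans_lt hΘ.2).ne rfl

/-- An essential bound becomes pointwise by continuity: a violation at `x'` would persist on a set
of positive measure near `x'`. The distances fit into the unit ball about `z` because the
discretisation error and `‖x' - x‖` are at most `1 / 4` each and the neighbourhood has radius `1 /
2`. -/
lemma enorm_le_siteEnvelope {Θ : EuclideanSpace ℝ (Fin d) → ℝ} {F : EuclideanSpace ℝ (Fin d) → ℂ}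
    (hF : Continuous F) {γ : EuclideanSpace ℝ (Fin d)} (hFΘ : ∀ x, ‖F x‖ ≤ Θ (x - γ))
    {x x' : EuclideanSpace ℝ (Fin d)} (hx : ‖x' - x‖ ≤ 1 / 4) :
    ‖F x'‖ₑ ≤ siteEnvelope Θ (site x - site γ) := by
  refine le_iInf₂ fun z hz => ?_
  have hz' := norm_sub_sub_le_of_site (x := x) (y := γ) (z := z) hz
  rw [eLpNorm_exponent_top]
  by_contra! hlt
  set M := eLpNormEssSup Θ (volume.restrict (ball z 1))
  have hopen : IsOpen ({y | M < ‖F y‖ₑ} ∩ ball x' (1 / 2)) :=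
    (isOpen_lt continuous_const hF.enorm).inter isOpen_ball
  have hpos := hopen.measure_pos volume ⟨x', hlt, mem_ball_self (by norm_num)⟩
  have hnull : volume ((fun y => y - γ) ⁻¹' ({u | ¬ ‖Θ u‖ₑ ≤ M} ∩ ball z 1)) = 0 := by
    simp_rw [sub_eq_add_neg]
    rw [measure_preimage_add_right]
    have := ae_le_eLpNormEssSup (f := Θ) (μ := volume.restrict (ball z 1))
    rw [ae_restrict_iff' measurableSet_ball, ae_iff] at this
    refine measure_mono_null (fun u hu => ?_) this
    intro h
    exact hu.1 (h hu.2)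
  refine hpos.ne' (measure_mono_null (t := (fun y => y - γ) ⁻¹' ({u | ¬ ‖Θ u‖ₑ ≤ M} ∩ ball z 1))
    (fun y hy => ⟨?_, ?_⟩) hnull)
  · refine not_le.2 (hy.1.trans_le ?_)
    rw [← ofReal_norm, ← ofReal_norm]
    exact ENNReal.ofReal_le_ofReal ((hFΘ y).trans (le_abs_self _))
  · have hy2 : ‖y - x'‖ < 1 / 2 := by simpa [dist_eq_norm] using hy.2
    rw [mem_ball, dist_eq_norm]
    have : y - γ - z = (y - x') + (x' - x) + (x - γ - z) := by abel
    rw [this]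
    have h3 := norm_add₃_le (a := y - x') (b := x' - x) (c := x - γ - z)
    linarith

end Envelope

/-! ### Sequence spaces as Lebesgue spaces of counting measure. -/

section SequenceSpaces

variable {I : Type*} [MeasurableSpace I] [MeasurableSingletonClass I]

lemma memℓp_iff_eLpNorm_count {p : ℝ≥0∞} (hp : 1 ≤ p) (c : I → ℂ) :
    Memℓp c p ↔ eLpNorm c p .count ≠ ∞ := by
  rcases eq_or_ne p ∞ with rfl | hpt
  · rw [memℓp_infty_iff, eLpNorm_exponent_top, eLpNormEssSup_count]
    constructor
    · rintro ⟨K, hK⟩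
      refine ne_top_of_le_ne_top (ENNReal.ofReal_ne_top (r := K)) (iSup_le fun i => ?_)
      rw [← ofReal_norm]
      exact ENNReal.ofReal_le_ofReal (hK ⟨i, rfl⟩)
    · intro h
      refine ⟨(⨆ i, ‖c i‖ₑ).toReal, ?_⟩
      rintro _ ⟨i, rfl⟩
      change ‖c i‖ ≤ _
      rw [← toReal_enorm]
      exact ENNReal.toReal_mono h (le_iSup (fun i => ‖c i‖ₑ) i)
  have hp0 : p ≠ 0 := (zero_lt_one.trans_le hp).ne'
  have hr0 : 0 < p.toReal := ENNReal.toReal_pos hp0 hpt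
  rw [memℓp_gen_iff hr0, eLpNorm_eq_lintegral_rpow_enorm_toReal hp0 hpt, lintegral_count,
    Ne, ENNReal.rpow_eq_top_iff_of_pos (by positivity), ← Ne]
  have h : ∀ i, ‖c i‖ₑ ^ p.toReal = ENNReal.ofReal (‖c i‖ ^ p.toReal) := fun i => by
    rw [← ofReal_norm, ENNReal.ofReal_rpow_of_nonneg (norm_nonneg _) hr0.le]
  simp_rw [h]
  constructor
  · exact fun h => h.tsum_ofReal_ne_top
  · intro h
    have h2 := ENNReal.summable_toReal h
    refine h2.congr fun i => ?_
    rw [ENNReal.toReal_ofReal (by positivity)]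

lemma norm_lp_eq {p : ℝ≥0∞} (hp : 1 ≤ p) (c : lp (fun _ : I => ℂ) p) :
    ‖c‖ = (eLpNorm c p .count).toReal := by
  rcases eq_or_ne p ∞ with rfl | hpt
  · rw [lp.norm_eq_ciSup, eLpNorm_exponent_top, eLpNormEssSup_count, ENNReal.toReal_iSup]
    · simp
    · simp
  have hp0 : p ≠ 0 := (zero_lt_one.trans_le hp).ne'
  have hr0 : 0 < p.toReal := ENNReal.toReal_pos hp0 hpt
  rw [lp.norm_eq_tsum_rpow hr0, eLpNorm_eq_lintegral_rpow_enorm_toReal hp0 hpt, lintegral_count,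
    ← ENNReal.toReal_rpow, ENNReal.tsum_toReal_eq]
  · simp_rw [← ENNReal.toReal_rpow, toReal_enorm]
  · exact fun i => ENNReal.rpow_ne_top_of_nonneg hr0.le enorm_ne_top

lemma tendsto_eLpNorm_indicator_compl {p : ℝ≥0∞} (hp : 1 ≤ p) (hpt : p ≠ ∞) {c : I → ℂ}
    (hc : eLpNorm c p .count ≠ ∞) :
    Tendsto (fun s : Finset I => eLpNorm ((s : Set I)ᶜ.indicator c) p .count) atTop (𝓝 0) := by
  have hp0 : p ≠ 0 := (zero_lt_one.trans_le hp).ne'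
  have hr0 : 0 < p.toReal := ENNReal.toReal_pos hp0 hpt
  rw [eLpNorm_eq_lintegral_rpow_enorm_toReal hp0 hpt, lintegral_count,
    Ne, ENNReal.rpow_eq_top_iff_of_pos (by positivity), ← Ne] at hc
  have h1 := ((ENNReal.continuous_rpow_const (y := 1 / p.toReal)).tendsto 0).comp
    (ENNReal.tendsto_tsum_compl_atTop_zero hc)
  rw [ENNReal.zero_rpow_of_pos (by positivity)] at h1
  refine h1.congr fun s => ?_
  rw [eLpNorm_eq_lintegral_rpow_enorm_toReal hp0 hpt, lintegral_count, Function.comp_apply]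
  congr 1
  refine (tsum_subtype ((s : Set I)ᶜ) fun i => ‖c i‖ₑ ^ p.toReal).trans (tsum_congr fun i => ?_)
  by_cases hi : i ∈ (s : Set I)ᶜ
  · simp [Set.indicator_of_mem hi]
  · simp [Set.indicator_of_notMem hi, hr0]

end SequenceSpaces

/-! ### Synthesis from localised atoms and the description of `V^p`. -/

section Atoms

variable {d : ℕ} {I : Type*}

/-- A family of continuous functions that are localised at given sites, with common envelope. -/
structure IsAtoms (F : I → EuclideanSpace ℝ (Fin d) → ℂ) (π : I → Fin d → ℤ)
    (w : (Fin d → ℤ) → ℝ≥0∞) : Prop where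
  continuous : ∀ i, Continuous (F i)
  le : ∀ i x x', ‖x' - x‖ ≤ 1 / 4 → ‖F i x'‖ₑ ≤ w (site x - π i)
  summable : ∑' s, w s ≠ ∞

lemma _root_.LocalizedFrame.isAtoms
    {V : Submodule ℂ (Lp ℂ 2 (volume : Measure (EuclideanSpace ℝ (Fin d))))}
    (Φ : LocalizedFrame V) :
    IsAtoms Φ.F (fun γ => site (γ : EuclideanSpace ℝ (Fin d))) (siteEnvelope Φ.envelope) :=
  ⟨Φ.continuous, fun γ _ _ h => enorm_le_siteEnvelope (Φ.continuous γ) (Φ.localized γ) h,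
    tsum_siteEnvelope_ne_top Φ.memAmalgam⟩

/-- The function `∑ c_i F_i`. -/
noncomputable def synth (F : I → EuclideanSpace ℝ (Fin d) → ℂ) (c : I → ℂ)
    (x : EuclideanSpace ℝ (Fin d)) : ℂ := ∑' i, c i * F i x

variable {F : I → EuclideanSpace ℝ (Fin d) → ℂ} {π : I → Fin d → ℤ} {w : (Fin d → ℤ) → ℝ≥0∞}

lemma IsAtoms.enorm_le (hF : IsAtoms F π w) (i : I) (x : EuclideanSpace ℝ (Fin d)) :
    ‖F i x‖ₑ ≤ w (site x - π i) := hF.le i x x (by simp)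

variable [MeasurableSpace I] [MeasurableSingletonClass I] [Countable I] {N : ℝ≥0∞}

lemma tsum_sited_mul_le (hI : IsSited .count π N) (w : (Fin d → ℤ) → ℝ≥0∞) (s : Fin d → ℤ)
    {c : I → ℂ} {K : ℝ≥0∞} (hcK : ∀ i, ‖c i‖ₑ ≤ K) :
    ∑' i, w (s - π i) * ‖c i‖ₑ ≤ N * (∑' s, w s) * K := by
  calc ∑' i, w (s - π i) * ‖c i‖ₑ ≤ ∑' i, w (s - π i) * K :=
        ENNReal.tsum_le_tsum fun i => mul_le_mul_right (hcK i) _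
    _ = (∫⁻ i, w (s - π i) ∂.count) * K := by rw [ENNReal.tsum_mul_right, lintegral_count]
    _ ≤ _ := by
        gcongr
        exact (hI.lintegral_comp_le fun t => w (s - t)).trans_eq (by rw [tsum_sub_left])

lemma IsAtoms.tsum_enorm_ne_top (hF : IsAtoms F π w) (hI : IsSited .count π N) {c : I → ℂ}
    {K : ℝ≥0∞} (hK : K ≠ ∞) (hcK : ∀ i, ‖c i‖ₑ ≤ K) (x : EuclideanSpace ℝ (Fin d)) :
    ∑' i, ‖c i * F i x‖ₑ ≠ ∞ := by
  refine ne_top_of_le_ne_top (ENNReal.mul_ne_top (ENNReal.mul_ne_top hI.ne_top hF.summable) hK)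
    (le_trans ?_ (tsum_sited_mul_le hI w (site x) hcK))
  refine ENNReal.tsum_le_tsum fun i => ?_
  rw [enorm_mul, mul_comm]
  gcongr
  exact hF.enorm_le i x

lemma IsAtoms.summable_mul (hF : IsAtoms F π w) (hI : IsSited .count π N) {c : I → ℂ}
    {K : ℝ≥0∞} (hK : K ≠ ∞) (hcK : ∀ i, ‖c i‖ₑ ≤ K) (x : EuclideanSpace ℝ (Fin d)) :
    Summable fun i => c i * F i x :=
  Summable.of_enorm (hF.tsum_enorm_ne_top hI hK hcK x)

/-- The Weierstrass test on a ball of radius `1 / 4`; the envelope bound for nearby points `x'` in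
`IsAtoms` is there for this. -/
lemma IsAtoms.continuous_synth (hF : IsAtoms F π w) (hI : IsSited .count π N) {c : I → ℂ}
    {K : ℝ≥0∞} (hK : K ≠ ∞) (hcK : ∀ i, ‖c i‖ₑ ≤ K) : Continuous (synth F c) := by
  rw [continuous_iff_continuousAt]
  intro x
  have hsum := ne_top_of_le_ne_top
    (ENNReal.mul_ne_top (ENNReal.mul_ne_top hI.ne_top hF.summable) hK)
    (tsum_sited_mul_le hI w (site x) hcK)
  have : ContinuousOn (synth F c) (ball x (1 / 4)) := by
    refine continuousOn_tsum (u := fun i => (w (site x - π i) * ‖c i‖ₑ).toReal)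
      (fun i => (continuous_const.mul (hF.continuous i)).continuousOn)
      (ENNReal.summable_toReal hsum) fun i x' hx' => ?_
    rw [← toReal_enorm, enorm_mul, mul_comm]
    refine ENNReal.toReal_mono (ENNReal.ne_top_of_tsum_ne_top hsum i) ?_
    gcongr
    refine hF.le i x x' ?_
    rw [mem_ball, dist_eq_norm] at hx'
    exact hx'.le
  exact this.continuousAt (ball_mem_nhds x (by norm_num))

lemma IsAtoms.enorm_synth_le (hF : IsAtoms F π w) (c : I → ℂ) (x : EuclideanSpace ℝ (Fin d)) :
    ‖synth F c x‖ₑ ≤ ∫⁻ i, w (site x - π i) * ‖c i‖ₑ ∂.count := by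
  rw [lintegral_count]
  refine enorm_tsum_le_tsum_enorm.trans (ENNReal.tsum_le_tsum fun i => ?_)
  rw [enorm_mul, mul_comm]
  gcongr
  exact hF.enorm_le i x

lemma IsAtoms.eLpNorm_synth_le (hF : IsAtoms F π w) (hI : IsSited .count π N)
    (hE : IsSited volume (site (d := d)) N) (c : I → ℂ) {p : ℝ≥0∞} (hp : 1 ≤ p) :
    eLpNorm (synth F c) p volume ≤ N * (∑' s, w s) * eLpNorm c p .count := by
  rw [← eLpNorm_enorm c]
  refine le_trans (eLpNorm_mono_enorm fun x => ?_)
    (eLpNorm_lintegral_conv_le hE hI hF.summable (measurable_of_countable _) hp)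
  rw [enorm_eq_self]
  exact hF.enorm_synth_le c x

lemma IsAtoms.eLpNorm_synth_comp_le {J : Type*} [MeasurableSpace J] [MeasurableSingletonClass J]
    [Countable J] (hF : IsAtoms F π w) (hI : IsSited .count π N)
    {y : J → EuclideanSpace ℝ (Fin d)} (hJ : IsSited .count (fun j => site (y j)) N) (c : I → ℂ)
    {p : ℝ≥0∞} (hp : 1 ≤ p) :
    eLpNorm (fun j => synth F c (y j)) p .count ≤ N * (∑' s, w s) * eLpNorm c p .count := by
  rw [← eLpNorm_enorm c]
  refine le_trans (eLpNorm_mono_enorm fun j => ?_)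
    (eLpNorm_lintegral_conv_le hJ hI hF.summable (measurable_of_countable _) hp)
  rw [enorm_eq_self]
  exact hF.enorm_synth_le c (y j)

/-- Term-by-term integration of `∑ c_i F_i` against an integrable function. -/
lemma IsAtoms.hasSum_integral (hF : IsAtoms F π w) (hI : IsSited .count π N) {c : I → ℂ}
    {K : ℝ≥0∞} (hK : K ≠ ∞) (hcK : ∀ i, ‖c i‖ₑ ≤ K) {g : EuclideanSpace ℝ (Fin d) → ℂ}
    (hg : Integrable g volume) :
    HasSum (fun i => ∫ x, c i * F i x * g x) (∫ x, synth F c x * g x) := by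
  have hmeas : ∀ i, AEStronglyMeasurable (fun x => c i * F i x * g x) volume := fun i =>
    ((continuous_const.mul (hF.continuous i)).aestronglyMeasurable).mul hg.1
  have h1 : ∑' i, ∫⁻ x, ‖c i * F i x * g x‖ₑ ≠ ∞ := by
    rw [← lintegral_tsum fun i => (hmeas i).enorm]
    refine ne_top_of_le_ne_top (b := ∫⁻ x, N * (∑' s, w s) * K * ‖g x‖ₑ) ?_
      (lintegral_mono fun x => ?_)
    · rw [lintegral_const_mul'' _ hg.1.enorm]
      exact ENNReal.mul_ne_top (ENNReal.mul_ne_top (ENNReal.mul_ne_top hI.ne_top hF.summable) hK)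
        hg.2.ne
    · simp_rw [enorm_mul (_ * _)]
      rw [ENNReal.tsum_mul_right]
      gcongr
      refine le_trans (ENNReal.tsum_le_tsum fun i => ?_) (tsum_sited_mul_le hI w (site x) hcK)
      rw [enorm_mul, mul_comm]
      gcongr
      exact hF.enorm_le i x
  have hint : ∀ i, Integrable (fun x => c i * F i x * g x) volume := fun i =>
    ⟨hmeas i, (ENNReal.ne_top_of_tsum_ne_top h1 i).lt_top⟩
  have h2 := hasSum_integral_of_summable_integral_norm hint ?_
  · simpa only [synth, tsum_mul_right] using h2
  · refine (ENNReal.summable_toReal h1).congr fun i => ?_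
    rw [integral_norm_eq_lintegral_enorm (hmeas i)]

lemma enorm_le_of_eLpNorm_count (c : I → ℂ) {p : ℝ≥0∞} (hp : 1 ≤ p) (i : I) :
    ‖c i‖ₑ ≤ eLpNorm c p .count :=
  enorm_le_eLpNorm_count c i (zero_lt_one.trans_le hp).ne'

lemma IsAtoms.sub_sum_eq_synth (hF : IsAtoms F π w) (hI : IsSited .count π N) {c : I → ℂ}
    {K : ℝ≥0∞} (hK : K ≠ ∞) (hcK : ∀ i, ‖c i‖ₑ ≤ K) (s : Finset I)
    (x : EuclideanSpace ℝ (Fin d)) :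
    synth F c x - ∑ i ∈ s, c i * F i x = synth F ((s : Set I)ᶜ.indicator c) x := by
  have h := (hF.summable_mul hI hK hcK x).sum_add_tsum_compl (s := s)
  rw [synth, synth, ← h, add_sub_cancel_left]
  refine (tsum_subtype ((s : Set I)ᶜ) fun i => c i * F i x).trans (tsum_congr fun i => ?_)
  by_cases hi : i ∈ (s : Set I)ᶜ
  · simp [Set.indicator_of_mem hi]
  · simp [Set.indicator_of_notMem hi]

lemma IsAtoms.lpSeriesConverges (hF : IsAtoms F π w) (hI : IsSited .count π N)
    (hE : IsSited volume (site (d := d)) N) {c : I → ℂ} {p : ℝ≥0∞} (hp : 1 ≤ p)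
    (hc : eLpNorm c p .count ≠ ∞) :
    LpSeriesConverges p (fun i x => c i * F i x) (synth F c) := by
  refine ⟨fun hpt => ?_, fun _ g hg => ?_⟩
  · simp_rw [hF.sub_sum_eq_synth hI hc (enorm_le_of_eLpNorm_count c hp)]
    have h := ENNReal.Tendsto.const_mul (tendsto_eLpNorm_indicator_compl hp hpt hc)
      (Or.inr (ENNReal.mul_ne_top hI.ne_top hF.summable))
    rw [mul_zero] at h
    exact tendsto_of_tendsto_of_tendsto_of_le_of_le tendsto_const_nhds h (fun _ => zero_le)
      fun s => hF.eLpNorm_synth_le hI hE _ hp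
  · exact hF.hasSum_integral hI hc (enorm_le_of_eLpNorm_count c hp) hg

/-- The limit is unique almost everywhere, by the triangle inequality in `L^p` or by testing against
smooth compactly supported functions if `p = ∞`. Two continuous functions that agree almost
everywhere are equal. -/
lemma IsAtoms.eq_synth (hF : IsAtoms F π w) (hI : IsSited .count π N)
    (hE : IsSited volume (site (d := d)) N) {c : I → ℂ} {p : ℝ≥0∞} (hp : 1 ≤ p)
    (hc : eLpNorm c p .count ≠ ∞) {f : EuclideanSpace ℝ (Fin d) → ℂ} (hf : Continuous f)
    (h : LpSeriesConverges p (fun i x => c i * F i x) f) : f = synth F c := by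
  have hcont := hF.continuous_synth hI hc (enorm_le_of_eLpNorm_count c hp)
  have h' := hF.lpSeriesConverges hI hE hp hc
  refine (Continuous.ae_eq_iff_eq volume hf hcont).1 ?_
  rcases eq_or_ne p ∞ with rfl | hpt
  · refine ae_eq_of_integral_contDiff_smul_eq hf.locallyIntegrable hcont.locallyIntegrable ?_
    intro g hg hgs
    have hgi : Integrable (fun x => (g x : ℂ)) volume :=
      (hg.continuous.integrable_of_hasCompactSupport hgs).ofReal
    have := (h.2 rfl _ hgi).unique (h'.2 rfl _ hgi)
    simpa only [Complex.real_smul, mul_comm] using this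
  · have hp0 : p ≠ 0 := (zero_lt_one.trans_le hp).ne'
    have hsum : ∀ s : Finset I, Continuous fun x => ∑ i ∈ s, c i * F i x := fun s =>
      continuous_finsetSum _ fun i _ => continuous_const.mul (hF.continuous i)
    have h1 : ∀ s : Finset I, eLpNorm (f - synth F c) p volume ≤
        eLpNorm (fun x => f x - ∑ i ∈ s, c i * F i x) p volume +
        eLpNorm (fun x => synth F c x - ∑ i ∈ s, c i * F i x) p volume := fun s => by
      have : f - synth F c = (fun x => f x - ∑ i ∈ s, c i * F i x) -
        (fun x => synth F c x - ∑ i ∈ s, c i * F i x) := by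
        ext x; simp
      rw [this]
      exact eLpNorm_sub_le (hf.sub (hsum s)).aestronglyMeasurable
        (hcont.sub (hsum s)).aestronglyMeasurable hp
    have h2 := ge_of_tendsto' ((h.1 hpt).add (h'.1 hpt)) h1
    rw [add_zero, nonpos_iff_eq_zero, eLpNorm_eq_zero_iff (hf.sub hcont).aestronglyMeasurable hp0]
      at h2
    filter_upwards [h2] with x hx
    simpa [sub_eq_zero] using hx

/-- The space `V^p` consists of the sums `∑ c_γ F_γ` with `c ∈ ℓ^p`. -/
theorem mem_rangeSpace_iff
    {V : Submodule ℂ (Lp ℂ 2 (volume : Measure (EuclideanSpace ℝ (Fin d))))}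
    (Φ : LocalizedFrame V) {p : ℝ≥0∞} (hp : 1 ≤ p) (f : EuclideanSpace ℝ (Fin d) → ℂ) :
    f ∈ Φ.rangeSpace p ↔ ∃ c : Φ.nodes → ℂ, eLpNorm c p .count ≠ ∞ ∧ f = synth Φ.F c := by
  have hcount := Φ.relativelySeparated.countable
  obtain ⟨N, hN⟩ := Φ.relativelySeparated.exists_isSited
  have hI := hN.mono (le_max_left N (cubeVol d)) (max_ne_top hN.ne_top cubeVol_ne_top)
  have hE := (isSited_volume (d := d)).mono (le_max_right N (cubeVol d)) hI.ne_top
  constructor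
  · rintro ⟨hf, -, c, hc⟩
    have hc' := (memℓp_iff_eLpNorm_count hp _).1 (lp.memℓp c)
    exact ⟨c, hc', Φ.isAtoms.eq_synth hI hE hp hc' hf hc⟩
  · rintro ⟨c, hc, rfl⟩
    have hcont := Φ.isAtoms.continuous_synth hI hc (enorm_le_of_eLpNorm_count c hp)
    refine ⟨hcont, ⟨hcont.aestronglyMeasurable, ?_⟩,
      ⟨c, (memℓp_iff_eLpNorm_count hp _).2 hc⟩, Φ.isAtoms.lpSeriesConverges hI hE hp hc⟩
    exact (Φ.isAtoms.eLpNorm_synth_le hI hE c hp).trans_lt (ENNReal.mul_lt_top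
      (ENNReal.mul_lt_top hI.ne_top.lt_top Φ.isAtoms.summable.lt_top) hc.lt_top)

end Atoms

/-! ### Dual frames of localised frames in Hilbert space. -/

section Frames

variable {H : Type*} [NormedAddCommGroup H] [InnerProductSpace ℂ H] [CompleteSpace H] {I : Type*}

/-- A frame in a Hilbert space. -/
structure IsHilbertFrame (e : I → H) (A B : ℝ) : Prop where
  pos : 0 < A
  summable : ∀ f, Summable fun i => ‖inner ℂ (e i) f‖ ^ 2
  lower : ∀ f, A * ‖f‖ ^ 2 ≤ ∑' i, ‖inner ℂ (e i) f‖ ^ 2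
  upper : ∀ f, ∑' i, ‖inner ℂ (e i) f‖ ^ 2 ≤ B * ‖f‖ ^ 2

variable {e : I → H} {A B : ℝ}

lemma IsHilbertFrame.exists_analysis (he : IsHilbertFrame e A B) :
    ∃ C : H →L[ℂ] lp (fun _ : I => ℂ) 2, (∀ f i, C f i = inner ℂ (e i) f) ∧
      ∀ f, A * ‖f‖ ^ 2 ≤ ‖C f‖ ^ 2 := by
  have h2 : (2 : ℝ≥0∞).toReal = 2 := by simp
  have hmem : ∀ f, Memℓp (fun i => inner ℂ (e i) f) 2 := fun f =>
    memℓp_gen (by simpa using he.summable f)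
  let L : H →ₗ[ℂ] lp (fun _ : I => ℂ) 2 :=
    { toFun := fun f => ⟨fun i => inner ℂ (e i) f, hmem f⟩
      map_add' := fun f g => by ext i; exact inner_add_right _ _ _
      map_smul' := fun a f => by ext i; exact inner_smul_right _ _ _ }
  have hL : ∀ f i, L f i = inner ℂ (e i) f := fun f i => rfl
  have hnorm : ∀ f, ‖L f‖ ^ 2 = ∑' i, ‖inner ℂ (e i) f‖ ^ 2 := fun f => by
    have := lp.norm_rpow_eq_tsum (p := 2) (by simp) (L f)
    simpa [hL] using this
  refine ⟨L.mkContinuous (Real.sqrt B) fun f => ?_, hL, fun f => ?_⟩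
  · refine le_of_sq_le_sq ?_ (by positivity)
    rw [hnorm, mul_pow]
    refine (he.upper f).trans ?_
    gcongr
    rcases le_total 0 B with hB | hB
    · rw [Real.sq_sqrt hB]
    · exact hB.trans (sq_nonneg _)
  · exact (he.lower f).trans_eq (hnorm f).symm


variable {C : H →L[ℂ] lp (fun _ : I => ℂ) 2}

lemma adjoint_single [DecidableEq I] (hC : ∀ f i, C f i = inner ℂ (e i) f) (i : I) (a : ℂ) :
    C.adjoint (lp.single 2 i a) = a • e i := by
  refine ext_inner_left ℂ fun f => ?_
  rw [ContinuousLinearMap.adjoint_inner_right, lp.inner_single_right, hC, inner_smul_right,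
    RCLike.inner_apply, inner_conj_symm]

lemma hasSum_adjoint (hC : ∀ f i, C f i = inner ℂ (e i) f) (c : lp (fun _ : I => ℂ) 2) :
    HasSum (fun i => c i • e i) (C.adjoint c) := by
  classical
  have h := (lp.hasSum_single (by simp) c).mapL C.adjoint
  simpa only [adjoint_single hC] using h

lemma hasSum_frameOp (hC : ∀ f i, C f i = inner ℂ (e i) f) (f : H) :
    HasSum (fun i => inner ℂ (e i) f • e i) (C.adjoint (C f)) := by
  simpa only [hC] using hasSum_adjoint hC (C f)

/-- The quadratic form of the frame operator is real and at least `A ‖f‖ ^ 2`, while `z` contributes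
at most `‖z‖ ‖f‖ ^ 2`. -/
lemma mul_norm_le_norm_sub_frameOp (hA : ∀ f, A * ‖f‖ ^ 2 ≤ ‖C f‖ ^ 2) (z : ℂ) (f : H) :
    (A - ‖z‖) * ‖f‖ ^ 2 ≤ ‖inner ℂ (z • f - C.adjoint (C f)) f‖ := by
  have h1 : inner ℂ (C.adjoint (C f)) f = ((‖C f‖ ^ 2 : ℝ) : ℂ) := by
    rw [ContinuousLinearMap.adjoint_inner_left, inner_self_eq_norm_sq_to_K]; norm_cast
  rw [inner_sub_left, h1, inner_smul_left, norm_sub_rev]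
  refine le_trans ?_ (norm_sub_norm_le _ _)
  rw [norm_mul, RCLike.norm_conj, Complex.norm_real, Real.norm_of_nonneg (by positivity),
    inner_self_eq_norm_sq_to_K]
  simp only [Complex.coe_algebraMap, norm_pow, Complex.norm_real, norm_norm]
  linarith [hA f]

lemma isUnit_sub_frameOp (hA : ∀ f, A * ‖f‖ ^ 2 ≤ ‖C f‖ ^ 2) {z : ℂ} (hz : ‖z‖ < A) :
    IsUnit (algebraMap ℂ (H →L[ℂ] H) z - C.adjoint ∘L C) := by
  refine ContinuousLinearMap.isUnit_of_forall_le_norm_inner_map _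
    (c := ⟨A - ‖z‖, by linarith⟩) (sub_pos.2 hz) fun f => ?_
  rw [mul_comm]
  exact mul_norm_le_norm_sub_frameOp hA z f

/-- Put `v = C C* c - z c`. Applying `C*` gives an equation for `C* c` with the operator `C* C - z`,
which is bounded below since `‖z‖ < A`; then `z c = C (C* c) - v` recovers `c`. Dividing by `z`
requires `z ≠ 0`, since `C C*` has a kernel when the frame is redundant. -/
lemma norm_le_norm_gram_sub (hA0 : 0 < A) (hA : ∀ f, A * ‖f‖ ^ 2 ≤ ‖C f‖ ^ 2) {z : ℂ}
    (hz : ‖z‖ = A / 2) (c : lp (fun _ : I => ℂ) 2) :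
    ‖c‖ ≤ 2 / A * (1 + ‖C‖ * (2 / A * ‖C.adjoint‖)) * ‖C (C.adjoint c) - z • c‖ := by
  set v := C (C.adjoint c) - z • c with hv
  set h := C.adjoint c
  have h1 : ‖h‖ ≤ 2 / A * ‖C.adjoint‖ * ‖v‖ := by
    have h2 : C.adjoint v = C.adjoint (C h) - z • h := by rw [hv, map_sub, map_smul]
    have h3 := mul_norm_le_norm_sub_frameOp hA z h
    rw [← neg_sub (C.adjoint (C h)), ← h2, inner_neg_left, norm_neg] at h3
    have h4 := h3.trans ((norm_inner_le_norm _ _).trans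
      (mul_le_mul_of_nonneg_right (C.adjoint.le_opNorm v) (norm_nonneg h)))
    rcases eq_or_ne ‖h‖ 0 with h0 | h0
    · rw [h0]; positivity
    have h5 : 0 < ‖h‖ := lt_of_le_of_ne (norm_nonneg _) h0.symm
    have h6 : (A / 2) * ‖h‖ ≤ ‖C.adjoint‖ * ‖v‖ := by
      refine le_of_mul_le_mul_right (le_trans (le_of_eq ?_) h4) h5
      rw [hz]; ring
    calc ‖h‖ = 2 / A * ((A / 2) * ‖h‖) := by field_simp
      _ ≤ 2 / A * (‖C.adjoint‖ * ‖v‖) := by gcongr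
      _ = _ := by ring
  have h2 : A / 2 * ‖c‖ ≤ ‖v‖ + ‖C‖ * ‖h‖ := by
    have : z • c = C h - v := by rw [hv]; abel
    rw [← hz, ← norm_smul, this]
    refine (norm_sub_le _ _).trans ?_
    linarith [C.le_opNorm h]
  calc ‖c‖ = 2 / A * (A / 2 * ‖c‖) := by field_simp
    _ ≤ 2 / A * (‖v‖ + ‖C‖ * (2 / A * ‖C.adjoint‖ * ‖v‖)) := by
        gcongr
        exact h2.trans (by gcongr)
    _ = _ := by ring

variable {d : ℕ} [MeasurableSpace I] [MeasurableSingletonClass I] {π : I → Fin d → ℤ} {N : ℝ≥0∞}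

open Classical in
lemma isBoundedBelow_gram_sub (hC : ∀ f i, C f i = inner ℂ (e i) f) (hA0 : 0 < A)
    (hA : ∀ f, A * ‖f‖ ^ 2 ≤ ‖C f‖ ^ 2) {z : ℂ} (hz : ‖z‖ = A / 2) :
    IsBoundedBelow (fun i j => inner ℂ (e i) (e j) - if i = j then z else 0) 2
      (ENNReal.ofReal (2 / A * (1 + ‖C‖ * (2 / A * ‖C.adjoint‖)))) := by
  intro s c hc
  set c' : lp (fun _ : I => ℂ) 2 := ∑ i ∈ s, lp.single 2 i (c i) with hc'
  have hcc : ∀ i, c' i = c i := fun i => by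
    rw [hc', lp.coeFn_sum, Finset.sum_apply]
    simp only [lp.single_apply, Finset.sum_pi_single]
    split_ifs with h
    · rfl
    · exact (hc i h).symm
  have hCc : C.adjoint c' = ∑ i ∈ s, c i • e i := by
    rw [hc', map_sum]
    simp only [adjoint_single hC]
  set v := C (C.adjoint c') - z • c' with hv
  have hvi : ∀ i, v i = ∑ j ∈ s, (inner ℂ (e i) (e j) - if i = j then z else 0) * c j := fun i => by
    rw [hv, lp.coeFn_sub, Pi.sub_apply, lp.coeFn_smul, Pi.smul_apply, hC, hCc, inner_sum, hcc]
    simp_rw [sub_mul, inner_smul_right, ite_mul, zero_mul]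
    rw [Finset.sum_sub_distrib, Finset.sum_ite_eq]
    congr 1
    · exact Finset.sum_congr rfl fun j _ => mul_comm _ _
    · split_ifs with h
      · rfl
      · rw [hc i h]; simp
  have h1 : eLpNorm c 2 .count = ENNReal.ofReal ‖c'‖ := by
    rw [norm_lp_eq (by norm_num) c', ENNReal.ofReal_toReal]
    · congr 1; ext i; exact (hcc i).symm
    · exact (memℓp_iff_eLpNorm_count (by norm_num) _).1 (lp.memℓp c')
  have h2 : eLpNorm (fun i => ∑ j ∈ s, (inner ℂ (e i) (e j) - if i = j then z else 0) * c j) 2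
      .count = ENNReal.ofReal ‖v‖ := by
    rw [norm_lp_eq (by norm_num) v, ENNReal.ofReal_toReal]
    · congr 1; ext i; exact (hvi i).symm
    · exact (memℓp_iff_eLpNorm_count (by norm_num) _).1 (lp.memℓp v)
  rw [h1, h2, ← ENNReal.ofReal_mul (by positivity)]
  exact ENNReal.ofReal_le_ofReal (norm_le_norm_gram_sub hA0 hA hz c')

/-- The dual frame of a frame with convolution-dominated Gram matrix: reconstruction holds, and the
dual frame coefficients of a vector are controlled by its frame coefficients. -/
theorem IsHilbertFrame.exists_localized_dual [Countable I] (he : IsHilbertFrame e A B)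
    (hI : IsSited .count π N) {w : (Fin d → ℤ) → ℝ≥0∞} (hw : ∑' s, w s ≠ ∞)
    (hG : ∀ i j, ‖inner ℂ (e i) (e j)‖ₑ ≤ w (π i - π j)) :
    ∃ (e' : I → H) (w' : (Fin d → ℤ) → ℝ≥0∞), ∑' s, w' s ≠ ∞ ∧
      (∀ f, HasSum (fun i => inner ℂ (e' i) f • e i) f) ∧
      ∀ f i, ‖inner ℂ (e' i) f‖ₑ ≤ ∑' j, w' (π i - π j) * ‖inner ℂ (e j) f‖ₑ := by
  classical
  obtain ⟨C, hC, hA⟩ := he.exists_analysis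
  have hA0 := he.pos
  set S : H →L[ℂ] H := C.adjoint ∘L C with hS
  have hunit : ∀ z : ℂ, ‖z‖ < A → z ∈ resolventSet ℂ S := fun z hz => isUnit_sub_frameOp hA hz
  have hw1 : ∑' s, (w s + if s = 0 then ENNReal.ofReal (A / 2) else 0) ≠ ∞ := by
    rw [ENNReal.tsum_add, tsum_ite_eq]
    exact ENNReal.add_ne_top.2 ⟨hw, ENNReal.ofReal_ne_top⟩
  -- One kernel for the whole circle `‖z‖ = A / 2`: the envelope, enlarged at the origin by `A / 2`,
  -- and the lower bound do not depend on `z`.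
  obtain ⟨w', hw', H'⟩ := enorm_le_tsum_of_isBoundedBelow hw1 hI hI (p := 2)
    (C := ENNReal.ofReal (2 / A * (1 + ‖C‖ * (2 / A * ‖C.adjoint‖)))) (by norm_num)
    ENNReal.ofReal_ne_top
  have hres : ∀ z : ℂ, ‖z‖ < A → ∀ f, z • resolvent S z f - S (resolvent S z f) = f := by
    intro z hz f
    have h1 : (algebraMap ℂ (H →L[ℂ] H) z - S) * resolvent S z = 1 :=
      Ring.mul_inverse_cancel _ (hunit z hz)
    have h2 := DFunLike.congr_fun h1 f
    simpa [Algebra.algebraMap_eq_smul_one] using h2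
  have hcirc : ∀ z : ℂ, ‖z‖ = A / 2 → ∀ f i, ‖inner ℂ (e i) (resolvent S z f)‖ₑ ≤
      ∑' j, w' (π i - π j) * ‖inner ℂ (e j) f‖ₑ := by
    intro z hz f i
    set h := resolvent S z f with hh
    have hb : ∀ i, ‖C h i‖ₑ ≤ ENNReal.ofReal ‖C h‖ := fun i => by
      rw [← ofReal_norm]
      exact ENNReal.ofReal_le_ofReal (lp.norm_apply_le_norm (by simp) _ i)
    have key := H' (fun i j => inner ℂ (e i) (e j) - if i = j then z else 0) (fun i j => ?_)
      (isBoundedBelow_gram_sub hC hA0 hA hz) (C h) _ ENNReal.ofReal_ne_top hb i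
    · rw [hC] at key
      refine key.trans_eq (tsum_congr fun j => ?_)
      have h1 : HasSum (fun i' => (inner ℂ (e j) (e i') - if j = i' then z else 0) * C h i')
          (inner ℂ (e j) (S h) - z * C h j) := by
        simp_rw [sub_mul, ite_mul, zero_mul]
        refine HasSum.sub ?_ ?_
        · have := (hasSum_adjoint hC (C h)).mapL (innerSL ℂ (e j))
          simp only [innerSL_apply_apply, inner_smul_right] at this
          exact this.congr_fun fun i' => mul_comm _ _
        · refine (hasSum_ite_eq j (z * C h j)).congr_fun fun i' => ?_
          by_cases hij : i' = j
          · simp [hij]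
          · simp [hij, Ne.symm hij]
      rw [h1.tsum_eq, hC, ← inner_smul_right, ← inner_sub_right, ← neg_sub (z • h),
        hres z (by linarith) f, inner_neg_right, enorm_neg]
    · refine (enorm_sub_le).trans (add_le_add (hG i j) ?_)
      split_ifs with h1 h2 h2
      · rw [← ofReal_norm, hz]
      · exact absurd (by rw [h1, sub_self]) h2
      · simp
      · simp
  -- The resolvent is holomorphic on `‖z‖ < A`, so the maximum modulus principle extends the bound
  -- from the circle to its centre, where the stability theorem does not apply directly.
  have hzero : ∀ f i, ‖inner ℂ (e i) (resolvent S (0 : ℂ) f)‖ₑ ≤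
      ∑' j, w' (π i - π j) * ‖inner ℂ (e j) f‖ₑ := by
    intro f i
    rcases eq_or_ne (∑' j, w' (π i - π j) * ‖inner ℂ (e j) f‖ₑ) ∞ with htop | htop
    · rw [htop]; exact le_top
    rw [← ofReal_norm]
    refine ENNReal.ofReal_le_of_le_toReal ?_
    have hdiff : DifferentiableOn ℂ (fun z : ℂ => inner ℂ (e i) (resolvent S z f)) (ball 0 A) := by
      intro z hz
      have h1 := (spectrum.hasDerivAt_resolvent_const_left
        (hunit z (by simpa using hz))).differentiableAt
      have h2 : DifferentiableAt ℂ (fun z : ℂ => resolvent S z f) z :=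
        ((ContinuousLinearMap.apply ℂ H f).differentiableAt).comp z h1
      exact (((innerSL ℂ (e i)).differentiableAt).comp z h2).differentiableWithinAt
    have hsub : closure (ball (0 : ℂ) (A / 2)) ⊆ ball 0 A :=
      closure_ball_subset_closedBall.trans (closedBall_subset_ball (by linarith))
    have hd : DiffContOnCl ℂ (fun z : ℂ => inner ℂ (e i) (resolvent S z f)) (ball 0 (A / 2)) :=
      (hdiff.mono hsub).diffContOnCl
    have hfr : ∀ z ∈ frontier (ball (0 : ℂ) (A / 2)), ‖inner ℂ (e i) (resolvent S z f)‖ ≤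
        (∑' j, w' (π i - π j) * ‖inner ℂ (e j) f‖ₑ).toReal := by
      intro z hz
      have hz' : ‖z‖ = A / 2 := by simpa using frontier_ball_subset_sphere hz
      rw [← toReal_enorm]
      exact ENNReal.toReal_mono htop (hcirc z hz' f i)
    have h0 : (0 : ℂ) ∈ closure (ball (0 : ℂ) (A / 2)) :=
      subset_closure (mem_ball_self (by positivity))
    have hmax := Complex.norm_le_of_forall_mem_frontier_norm_le
      (f := fun z : ℂ => (inner ℂ (e i) (resolvent S z f) : ℂ)) isBounded_ball hd hfr h0
    exact hmax
  -- The resolvent at `0` is minus the inverse of the frame operator, which explains the sign.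
  refine ⟨fun i => -(resolvent S (0 : ℂ)).adjoint (e i), w', hw', fun f => ?_, fun f i => ?_⟩
  · have h1 := hasSum_frameOp hC (-resolvent S (0 : ℂ) f)
    have h2 : C.adjoint (C (-resolvent S (0 : ℂ) f)) = f := by
      have := hres 0 (by simpa using hA0) f
      simpa [hS] using this
    rw [h2] at h1
    refine h1.congr_fun fun i => ?_
    rw [inner_neg_left, ContinuousLinearMap.adjoint_inner_left, inner_neg_right]
  · rw [inner_neg_left, enorm_neg, ContinuousLinearMap.adjoint_inner_left]
    exact hzero f i

end Frames

/-! ### Algebra of convolution-dominated matrices. -/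

section Matrices

variable {d : ℕ} {I J K : Type*} {πI : I → Fin d → ℤ} {πJ : J → Fin d → ℤ} {πK : K → Fin d → ℤ}

/-- Convolution-dominated matrices. -/
def IsConvDom (A : J → I → ℂ) (πJ : J → Fin d → ℤ) (πI : I → Fin d → ℤ) : Prop :=
  ∃ w : (Fin d → ℤ) → ℝ≥0∞, ∑' s, w s ≠ ∞ ∧ ∀ j i, ‖A j i‖ₑ ≤ w (πJ j - πI i)

lemma tsum_comp_neg (w : (Fin d → ℤ) → ℝ≥0∞) : ∑' s, w (-s) = ∑' s, w s :=
  (Equiv.neg _).tsum_eq w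

lemma IsConvDom.of_enorm_le_transpose {A : J → I → ℂ} {B : I → J → ℂ} (hA : IsConvDom A πJ πI)
    (h : ∀ i j, ‖B i j‖ₑ ≤ ‖A j i‖ₑ) : IsConvDom B πI πJ := by
  obtain ⟨w, hw, hA⟩ := hA
  refine ⟨fun s => w (-s), by rwa [tsum_comp_neg], fun i j => ?_⟩
  simp only [neg_sub]
  exact (h i j).trans (hA j i)

lemma IsConvDom.sub {A B : J → I → ℂ} (hA : IsConvDom A πJ πI) (hB : IsConvDom B πJ πI) :
    IsConvDom (fun j i => A j i - B j i) πJ πI := by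
  obtain ⟨w, hw, hA⟩ := hA
  obtain ⟨v, hv, hB⟩ := hB
  refine ⟨fun s => w s + v s, ?_, fun j i => enorm_sub_le.trans (add_le_add (hA j i) (hB j i))⟩
  rw [ENNReal.tsum_add]
  exact ENNReal.add_ne_top.2 ⟨hw, hv⟩

open Classical in
lemma isConvDom_one : IsConvDom (fun i j : I => if i = j then 1 else 0) πI πI := by
  refine ⟨fun s => if s = 0 then 1 else 0, by rw [tsum_ite_eq]; simp, fun i j => ?_⟩
  dsimp only
  split_ifs with h1 h2 h2
  · simp
  · exact absurd (by rw [h1, sub_self]) h2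
  · simp
  · simp

lemma IsConvDom.sumElim {A : J → I → ℂ} {B : K → I → ℂ} (hA : IsConvDom A πJ πI)
    (hB : IsConvDom B πK πI) :
    IsConvDom (fun l i => Sum.elim (fun j => A j i) (fun k => B k i) l) (Sum.elim πJ πK) πI := by
  obtain ⟨w, hw, hA⟩ := hA
  obtain ⟨v, hv, hB⟩ := hB
  refine ⟨fun s => w s + v s, ?_, ?_⟩
  · rw [ENNReal.tsum_add]
    exact ENNReal.add_ne_top.2 ⟨hw, hv⟩
  · rintro (j | k) i
    · exact (hA j i).trans le_self_add
    · exact (hB k i).trans le_add_self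

lemma tsum_comm_of_enorm {f : I → J → ℂ} (h : ∑' i, ∑' j, ‖f i j‖ₑ ≠ ∞) :
    ∑' i, ∑' j, f i j = ∑' j, ∑' i, f i j := by
  refine (Summable.tsum_comm (f := f) (Summable.of_enorm ?_)).symm
  rwa [ENNReal.tsum_prod' (f := fun q : I × J => ‖Function.uncurry f q‖ₑ)]

lemma IsAtoms.isConvDom {F : I → EuclideanSpace ℝ (Fin d) → ℂ} {w : (Fin d → ℤ) → ℝ≥0∞}
    (hF : IsAtoms F πI w) (y : J → EuclideanSpace ℝ (Fin d)) :
    IsConvDom (fun j i => F i (y j)) (fun j => site (y j)) πI :=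
  ⟨w, hF.summable, fun j i => hF.enorm_le i (y j)⟩

lemma synth_eq (F : I → EuclideanSpace ℝ (Fin d) → ℂ) (c : I → ℂ) (x : EuclideanSpace ℝ (Fin d)) :
    synth F c x = ∑' i, F i x * c i := tsum_congr fun _ => mul_comm _ _

variable [MeasurableSpace I] [MeasurableSingletonClass I] {N : ℝ≥0∞}

/-- Only domination by a product is required, because the dual frame is known through an inequality
and not through a matrix factorisation. -/
lemma IsConvDom.of_enorm_le_tsum {A : K → I → ℂ} {B : I → J → ℂ} {P : K → J → ℂ}
    (hI : IsSited .count πI N) (hA : IsConvDom A πK πI) (hB : IsConvDom B πI πJ)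
    (h : ∀ k j, ‖P k j‖ₑ ≤ ∑' i, ‖A k i‖ₑ * ‖B i j‖ₑ) : IsConvDom P πK πJ := by
  obtain ⟨w, hw, hA⟩ := hA
  obtain ⟨v, hv, hB⟩ := hB
  refine ⟨fun s => N * conv w v s, ?_, fun k j => (h k j).trans ?_⟩
  · rw [ENNReal.tsum_mul_left, tsum_conv]
    exact ENNReal.mul_ne_top hI.ne_top (ENNReal.mul_ne_top hw hv)
  · refine le_trans ?_ (lintegral_conv_le hI w v (πK k) (πJ j))
    rw [lintegral_count]
    exact ENNReal.tsum_le_tsum fun i => mul_le_mul' (hA k i) (hB i j)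

lemma IsConvDom.exists_tsum_enorm_le {A : J → I → ℂ} (hA : IsConvDom A πJ πI)
    (hI : IsSited .count πI N) : ∃ L : ℝ≥0∞, L ≠ ∞ ∧ ∀ j, ∑' i, ‖A j i‖ₑ ≤ L := by
  obtain ⟨w, hw, hA⟩ := hA
  refine ⟨N * ∑' s, w s, ENNReal.mul_ne_top hI.ne_top hw, fun j => ?_⟩
  refine (ENNReal.tsum_le_tsum fun i => hA j i).trans ?_
  rw [← lintegral_count, ← tsum_sub_left w (πJ j)]
  exact hI.lintegral_comp_le fun s => w (πJ j - s)

lemma IsConvDom.summable_mul {A : J → I → ℂ} (hA : IsConvDom A πJ πI)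
    (hI : IsSited .count πI N) {c : I → ℂ} {L : ℝ≥0∞} (hL : L ≠ ∞) (hc : ∀ i, ‖c i‖ₑ ≤ L) (j : J) :
    Summable fun i => A j i * c i := by
  obtain ⟨L', hL', h⟩ := hA.exists_tsum_enorm_le hI
  refine Summable.of_enorm (ne_top_of_le_ne_top (ENNReal.mul_ne_top hL' hL)
    (le_trans ?_ (mul_le_mul_left (h j) L)))
  rw [← ENNReal.tsum_mul_right]
  exact ENNReal.tsum_le_tsum fun i => (enorm_mul _ _).trans_le (mul_le_mul_right (hc i) _)

lemma IsConvDom.exists_eLpNorm_le [Countable I] [MeasurableSpace J] [MeasurableSingletonClass J]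
    [Countable J] {A : J → I → ℂ} (hA : IsConvDom A πJ πI) (hI : IsSited .count πI N)
    (hJ : IsSited .count πJ N) : ∃ L : ℝ≥0∞, L ≠ ∞ ∧ ∀ (p : ℝ≥0∞), 1 ≤ p → ∀ c : I → ℂ,
      eLpNorm (fun j => ∑' i, A j i * c i) p .count ≤ L * eLpNorm c p .count := by
  obtain ⟨w, hw, hA⟩ := hA
  refine ⟨N * ∑' s, w s, ENNReal.mul_ne_top hI.ne_top hw, fun p hp c => ?_⟩
  rw [← eLpNorm_enorm c]
  refine le_trans (eLpNorm_mono_enorm fun j => ?_)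
    (eLpNorm_lintegral_conv_le hJ hI hw (measurable_of_countable _) hp)
  rw [enorm_eq_self, lintegral_count]
  refine enorm_tsum_le_tsum_enorm.trans (ENNReal.tsum_le_tsum fun i => ?_)
  rw [enorm_mul]
  gcongr
  exact hA j i

/-- Products of convolution-dominated matrices act associatively on bounded vectors. -/
lemma IsConvDom.tsum_mul_tsum [MeasurableSpace J] [MeasurableSingletonClass J]
    {A : K → I → ℂ} {B : I → J → ℂ} (hA : IsConvDom A πK πI) (hB : IsConvDom B πI πJ)
    (hI : IsSited .count πI N) {N' : ℝ≥0∞} (hJ : IsSited .count πJ N') {c : J → ℂ} {L : ℝ≥0∞}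
    (hL : L ≠ ∞)
    (hc : ∀ j, ‖c j‖ₑ ≤ L) (k : K) :
    ∑' i, A k i * ∑' j, B i j * c j = ∑' j, (∑' i, A k i * B i j) * c j := by
  simp_rw [← tsum_mul_left, ← tsum_mul_right]
  rw [tsum_comm_of_enorm]
  · exact tsum_congr fun j => tsum_congr fun i => by ring
  · obtain ⟨L₁, hL₁, h₁⟩ := hA.exists_tsum_enorm_le hI
    obtain ⟨L₂, hL₂, h₂⟩ := hB.exists_tsum_enorm_le hJ
    refine ne_top_of_le_ne_top (ENNReal.mul_ne_top hL₁ (ENNReal.mul_ne_top hL₂ hL))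
      (le_trans ?_ (mul_le_mul_left (h₁ k) _))
    rw [← ENNReal.tsum_mul_right]
    refine ENNReal.tsum_le_tsum fun i => ?_
    simp_rw [enorm_mul]
    rw [ENNReal.tsum_mul_left]
    gcongr
    refine le_trans ?_ (mul_le_mul_left (h₂ i) L)
    rw [← ENNReal.tsum_mul_right]
    exact ENNReal.tsum_le_tsum fun j => mul_le_mul_right (hc j) _

end Matrices

/-! ### Gram matrices between two localised frames of the same space. -/

section Transition

variable {d : ℕ} {V : Submodule ℂ (Lp ℂ 2 (volume : Measure (EuclideanSpace ℝ (Fin d))))}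

/-- The sites of the nodes of a localised frame. -/
noncomputable def _root_.LocalizedFrame.nodeSite (Φ : LocalizedFrame V) (γ : Φ.nodes) :
    Fin d → ℤ := site (γ : EuclideanSpace ℝ (Fin d))

/-- The frame elements as vectors of the subspace. -/
noncomputable def _root_.LocalizedFrame.vec (Φ : LocalizedFrame V) (γ : Φ.nodes) : V :=
  ⟨(Φ.memLp γ).toLp (Φ.F γ), Φ.mem γ⟩

lemma inner_vec (Φ Ψ : LocalizedFrame V) (γ : Φ.nodes) (δ : Ψ.nodes) :
    inner ℂ (Φ.vec γ) (Ψ.vec δ) = ∫ x, Ψ.F δ x * starRingEnd ℂ (Φ.F γ x) := by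
  change inner ℂ ((Φ.memLp γ).toLp (Φ.F γ)) ((Ψ.memLp δ).toLp (Ψ.F δ)) = _
  rw [L2.inner_def]
  refine integral_congr_ae ?_
  filter_upwards [(Φ.memLp γ).coeFn_toLp, (Ψ.memLp δ).coeFn_toLp] with x h1 h2
  rw [h1, h2, RCLike.inner_apply]

/-- Integrating the product of two envelopes about different sites gives their convolution, one of
them reflected. -/
lemma isConvDom_inner_vec (Φ Ψ : LocalizedFrame V) :
    IsConvDom (fun γ δ => inner ℂ (Φ.vec γ) (Ψ.vec δ)) Φ.nodeSite Ψ.nodeSite := by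
  set w := fun s => siteEnvelope Φ.envelope (-s) with hw
  set v := siteEnvelope Ψ.envelope
  refine ⟨fun s => cubeVol d * conv w v s, ?_, fun γ δ => ?_⟩
  · rw [ENNReal.tsum_mul_left, tsum_conv, hw, tsum_comp_neg]
    exact ENNReal.mul_ne_top cubeVol_ne_top
      (ENNReal.mul_ne_top Φ.isAtoms.summable Ψ.isAtoms.summable)
  · refine le_trans ?_ (lintegral_conv_le isSited_volume w v (Φ.nodeSite γ) (Ψ.nodeSite δ))
    dsimp only
    rw [inner_vec]
    refine (enorm_integral_le_lintegral_enorm _).trans (lintegral_mono fun x => ?_)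
    rw [enorm_mul, RCLike.enorm_conj, mul_comm]
    refine mul_le_mul' ?_ (Ψ.isAtoms.enorm_le δ x)
    simp only [hw, neg_sub]
    exact Φ.isAtoms.enorm_le γ x

lemma _root_.LocalizedFrame.exists_isHilbertFrame (Φ : LocalizedFrame V) :
    ∃ A B, IsHilbertFrame Φ.vec A B := by
  obtain ⟨A, B, hA, -, h⟩ := Φ.frame
  exact ⟨A, B, hA, fun f => (h f f.2).1, fun f => (h f f.2).2.1, fun f => (h f f.2).2.2⟩

lemma eLpNorm_sub_sum_eq {I : Type*} {F : I → EuclideanSpace ℝ (Fin d) → ℂ}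
    (hF : ∀ i, MemLp (F i) 2 volume) {f : EuclideanSpace ℝ (Fin d) → ℂ} (hf : MemLp f 2 volume)
    (c : I → ℂ) (s : Finset I) :
    eLpNorm (fun x => f x - ∑ i ∈ s, c i * F i x) 2 volume =
      ‖hf.toLp f - ∑ i ∈ s, c i • (hF i).toLp (F i)‖ₑ := by
  classical
  have hs : ∀ s : Finset I, (⇑(∑ i ∈ s, c i • (hF i).toLp (F i)) : EuclideanSpace ℝ (Fin d) → ℂ)
      =ᵐ[volume] fun x => ∑ i ∈ s, c i * F i x := by
    intro s
    induction s using Finset.induction_on with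
    | empty => simpa using! Lp.coeFn_zero ℂ 2 volume
    | insert i s hi ih =>
      rw [Finset.sum_insert hi]
      filter_upwards [Lp.coeFn_add (c i • (hF i).toLp (F i)) (∑ i ∈ s, c i • (hF i).toLp (F i)), ih,
        Lp.coeFn_smul (c i) ((hF i).toLp (F i)), (hF i).coeFn_toLp] with x h1 h2 h3 h4
      rw [h1, Pi.add_apply, h2, h3, Finset.sum_insert hi, Pi.smul_apply, h4, smul_eq_mul]
  rw [Lp.enorm_def]
  refine eLpNorm_congr_ae ?_
  filter_upwards [Lp.coeFn_sub (hf.toLp f) (∑ i ∈ s, c i • (hF i).toLp (F i)), hs s,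
    hf.coeFn_toLp] with x h1 h2 h3
  rw [h1, Pi.sub_apply, h2, h3]

/-- An expansion of a continuous function in a localised frame, with summable coefficients, that
converges in `L^2`, converges to it pointwise. -/
lemma eq_synth_of_hasSum_vec (Φ Ψ : LocalizedFrame V) (δ : Ψ.nodes) {c : Φ.nodes → ℂ}
    (hc : eLpNorm c 2 .count ≠ ∞) (h : HasSum (fun γ => c γ • Φ.vec γ) (Ψ.vec δ)) :
    Ψ.F δ = synth Φ.F c := by
  have hcount := Φ.relativelySeparated.countable
  obtain ⟨N, hN⟩ := Φ.relativelySeparated.exists_isSited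
  have hI := hN.mono (le_max_left N (cubeVol d)) (max_ne_top hN.ne_top cubeVol_ne_top)
  have hE := (isSited_volume (d := d)).mono (le_max_right N (cubeVol d)) hI.ne_top
  refine Φ.isAtoms.eq_synth hI hE (by norm_num) hc (Ψ.continuous δ) ⟨fun _ => ?_, fun h2 => ?_⟩
  · have h' := h.mapL V.subtypeL
    have h'' : Tendsto (fun s : Finset Φ.nodes => ∑ γ ∈ s, V.subtypeL (c γ • Φ.vec γ)) atTop
        (𝓝 (V.subtypeL (Ψ.vec δ))) := by
      simpa only [HasSum, SummationFilter.unconditional_filter] using h'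
    have h3 := (h''.const_sub (V.subtypeL (Ψ.vec δ))).enorm
    rw [sub_self] at h3
    rw [enorm_zero] at h3
    refine h3.congr fun s => ?_
    rw [eLpNorm_sub_sum_eq Φ.memLp (Ψ.memLp δ)]
    rfl
  · exact absurd h2 (by simp)

end Transition

/-! ### Localised dual frames and change of frame. -/

section Transition

variable {d : ℕ} {V : Submodule ℂ (Lp ℂ 2 (volume : Measure (EuclideanSpace ℝ (Fin d))))}

lemma IsAtoms.integrable {I : Type*} {F : I → EuclideanSpace ℝ (Fin d) → ℂ} {π : I → Fin d → ℤ}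
    {w : (Fin d → ℤ) → ℝ≥0∞} (hF : IsAtoms F π w) (i : I) : Integrable (F i) volume := by
  refine ⟨(hF.continuous i).aestronglyMeasurable, ?_⟩
  refine (lintegral_mono fun x => hF.enorm_le i x).trans_lt ?_
  refine (isSited_volume.lintegral_comp_le fun s => w (s - π i)).trans_lt ?_
  rw [tsum_sub_right]
  exact ENNReal.mul_lt_top cubeVol_ne_top.lt_top hF.summable.lt_top

lemma eLpNorm_column_ne_top {I J : Type*} [MeasurableSpace I] [MeasurableSingletonClass I]
    {πI : I → Fin d → ℤ} {πJ : J → Fin d → ℤ} {N : ℝ≥0∞} {A : I → J → ℂ}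
    (hA : IsConvDom A πI πJ) (hI : IsSited .count πI N) {p : ℝ≥0∞} (hp : 1 ≤ p) (j : J) :
    eLpNorm (fun i => A i j) p .count ≠ ∞ := by
  obtain ⟨L, hL, h⟩ := (hA.of_enorm_le_transpose (B := fun j i => A i j)
    fun _ _ => le_rfl).exists_tsum_enorm_le hI
  exact ne_top_of_le_ne_top hL ((eLpNorm_count_le_tsum _ hp).trans (h j))

section Abstract

variable {H : Type*} [NormedAddCommGroup H] [InnerProductSpace ℂ H] {I : Type*}

lemma hasSum_inner_mul_inner {e e' : I → H} {f : H}
    (h : HasSum (fun i => inner ℂ (e' i) f • e i) f) (g : H) :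
    HasSum (fun i => inner ℂ g (e i) * inner ℂ (e' i) f) (inner ℂ g f) := by
  have := h.mapL (innerSL ℂ g)
  simp only [innerSL_apply_apply, inner_smul_right] at this
  exact this.congr_fun fun i => mul_comm _ _

lemma hasSum_inner_mul_inner' {e e' : I → H} {f : H}
    (h : HasSum (fun i => inner ℂ (e' i) f • e i) f) (g : H) :
    HasSum (fun i => inner ℂ f (e' i) * inner ℂ (e i) g) (inner ℂ f g) := by
  have := Complex.hasSum_conj'.2 (hasSum_inner_mul_inner h g)
  simp only [map_mul, inner_conj_symm] at this
  exact this.congr_fun fun i => mul_comm _ _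

/-- A frame with convolution-dominated Gram matrix has a localised dual frame. -/
lemma IsHilbertFrame.exists_dual [CompleteSpace H] [MeasurableSpace I] [MeasurableSingletonClass I]
    [Countable I] {e : I → H} {A B : ℝ} (he : IsHilbertFrame e A B) {π : I → Fin d → ℤ}
    {N : ℝ≥0∞} (hI : IsSited .count π N)
    (hG : IsConvDom (fun i j => inner ℂ (e i) (e j)) π π) :
    ∃ e' : I → H, (∀ f, HasSum (fun i => inner ℂ (e' i) f • e i) f) ∧
      IsConvDom (fun i j => inner ℂ (e' i) (e' j)) π π ∧
      ∀ {J : Type} (v : J → H) (ρ : J → Fin d → ℤ),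
        IsConvDom (fun i j => inner ℂ (e i) (v j)) π ρ →
        IsConvDom (fun i j => inner ℂ (e' i) (v j)) π ρ := by
  obtain ⟨w, hw, hG'⟩ := hG
  obtain ⟨e', w', hw', h1, h2⟩ := he.exists_localized_dual hI hw hG'
  have hn : ∀ s, ‖((w' s).toReal : ℂ)‖ₑ = w' s := fun s => by
    rw [← ofReal_norm, Complex.norm_real, Real.norm_of_nonneg ENNReal.toReal_nonneg,
      ENNReal.ofReal_toReal (ENNReal.ne_top_of_tsum_ne_top hw' _)]
  have hK : IsConvDom (fun i j => ((w' (π i - π j)).toReal : ℂ)) π π :=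
    ⟨w', hw', fun i j => (hn _).le⟩
  have h3 : ∀ {J : Type _} (v : J → H) (ρ : J → Fin d → ℤ),
      IsConvDom (fun i j => inner ℂ (e i) (v j)) π ρ →
      IsConvDom (fun i j => inner ℂ (e' i) (v j)) π ρ := fun v ρ hv =>
    IsConvDom.of_enorm_le_tsum hI hK hv fun i j =>
      (h2 (v j) i).trans_eq (tsum_congr fun k => by rw [hn])
  refine ⟨e', h1, ?_, h3⟩
  -- The coefficient estimate is used twice: for the vectors `e j`, and, after conjugate symmetry,
  -- for the dual vectors themselves.
  have h4 : IsConvDom (fun i j => inner ℂ (e' i) (e j)) π π :=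
    IsConvDom.of_enorm_le_tsum hI hK ⟨w, hw, hG'⟩ fun i j =>
      (h2 (e j) i).trans_eq (tsum_congr fun k => by rw [hn])
  have h5 : IsConvDom (fun i j => inner ℂ (e i) (e' j)) π π :=
    h4.of_enorm_le_transpose fun i j => by rw [← inner_conj_symm, RCLike.enorm_conj]
  exact IsConvDom.of_enorm_le_tsum hI hK h5 fun i j =>
      (h2 (e' j) i).trans_eq (tsum_congr fun k => by rw [hn])

end Abstract

/-- A localised frame has a localised dual frame. -/
lemma exists_dual (hV : IsClosed (V : Set (Lp ℂ 2 (volume : Measure (EuclideanSpace ℝ (Fin d))))))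
    (Φ : LocalizedFrame V) :
    ∃ e' : Φ.nodes → V, (∀ f, HasSum (fun γ => inner ℂ (e' γ) f • Φ.vec γ) f) ∧
      IsConvDom (fun γ γ' => inner ℂ (e' γ) (e' γ')) Φ.nodeSite Φ.nodeSite ∧
      ∀ Ψ : LocalizedFrame V,
        IsConvDom (fun γ δ => inner ℂ (e' γ) (Ψ.vec δ)) Φ.nodeSite Ψ.nodeSite := by
  have : CompleteSpace V := hV.completeSpace_coe
  have hcount := Φ.relativelySeparated.countable
  obtain ⟨N, hN⟩ := Φ.relativelySeparated.exists_isSited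
  obtain ⟨A, B, hAB⟩ := Φ.exists_isHilbertFrame
  obtain ⟨e', h1, h2, h3⟩ := hAB.exists_dual (π := Φ.nodeSite) hN (isConvDom_inner_vec Φ Φ)
  exact ⟨e', h1, h2, fun Ψ => h3 Ψ.vec Ψ.nodeSite (isConvDom_inner_vec Φ Ψ)⟩

lemma integral_synth_mul_conj (Φ Ψ : LocalizedFrame V) {N : ℝ≥0∞}
    (hΨ : IsSited .count Ψ.nodeSite N) {c : Ψ.nodes → ℂ} {K : ℝ≥0∞} (hK : K ≠ ∞)
    (hcK : ∀ δ, ‖c δ‖ₑ ≤ K) (γ : Φ.nodes) :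
    ∫ x, synth Ψ.F c x * starRingEnd ℂ (Φ.F γ x) =
      ∑' δ, inner ℂ (Φ.vec γ) (Ψ.vec δ) * c δ := by
  have hcΨ := Ψ.relativelySeparated.countable
  have hint : Integrable (fun x => starRingEnd ℂ (Φ.F γ x)) volume :=
    ⟨(Complex.continuous_conj.comp (Φ.continuous γ)).aestronglyMeasurable,
      (Φ.isAtoms.integrable γ).2.congr' (Eventually.of_forall fun x => by simp)⟩
  rw [← (Ψ.isAtoms.hasSum_integral hΨ hK hcK hint).tsum_eq]
  refine tsum_congr fun δ => ?_
  simp_rw [mul_assoc]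
  rw [integral_const_mul, inner_vec, mul_comm]

lemma eLpNorm_integral_mul_conj_le (Φ : LocalizedFrame V) {N : ℝ≥0∞}
    (hΦ : IsSited .count Φ.nodeSite N) (hE : IsSited volume (site (d := d)) N)
    {f : EuclideanSpace ℝ (Fin d) → ℂ} (hf : Continuous f) {q : ℝ≥0∞} (hq : 1 ≤ q) :
    eLpNorm (fun γ => ∫ x, f x * starRingEnd ℂ (Φ.F γ x)) q .count ≤
      N * (∑' s, siteEnvelope Φ.envelope (-s)) * eLpNorm f q volume := by
  have hcΦ := Φ.relativelySeparated.countable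
  have hw : ∑' s, siteEnvelope Φ.envelope (-s) ≠ ∞ := by
    rw [tsum_comp_neg]; exact Φ.isAtoms.summable
  rw [← eLpNorm_enorm f]
  refine le_trans (eLpNorm_mono_enorm fun γ => ?_)
    (eLpNorm_lintegral_conv_le hΦ hE hw hf.enorm.measurable hq)
  rw [enorm_eq_self]
  refine (enorm_integral_le_lintegral_enorm _).trans (lintegral_mono fun x => ?_)
  rw [enorm_mul, RCLike.enorm_conj, mul_comm, neg_sub]
  exact mul_le_mul_left (Φ.isAtoms.enorm_le γ x) _

/-- The dual frame coefficients of `∑ d_δ Ψ_δ` are bounded in `ℓ^q` by its norm in `L^q`. -/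
lemma exists_eLpNorm_coeff_le (Φ Ψ : LocalizedFrame V) {e' : Φ.nodes → V}
    (h1 : ∀ f, HasSum (fun γ => inner ℂ (e' γ) f • Φ.vec γ) f)
    (h2 : IsConvDom (fun γ γ' => inner ℂ (e' γ) (e' γ')) Φ.nodeSite Φ.nodeSite) :
    ∃ L : ℝ≥0∞, L ≠ ∞ ∧ ∀ q : ℝ≥0∞, 1 ≤ q → ∀ c : Ψ.nodes → ℂ, eLpNorm c q .count ≠ ∞ →
      eLpNorm (fun γ => ∑' δ, inner ℂ (e' γ) (Ψ.vec δ) * c δ) q .count ≤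
        L * eLpNorm (synth Ψ.F c) q volume := by
  have hcΦ := Φ.relativelySeparated.countable
  have hcΨ := Ψ.relativelySeparated.countable
  obtain ⟨N₁, hN₁⟩ := Φ.relativelySeparated.exists_isSited
  obtain ⟨N₂, hN₂⟩ := Ψ.relativelySeparated.exists_isSited
  have hN : max N₁ (cubeVol d) ≠ ∞ := max_ne_top hN₁.ne_top cubeVol_ne_top
  have hΦ : IsSited .count Φ.nodeSite (max N₁ (cubeVol d)) := hN₁.mono (le_max_left _ _) hN
  have hE : IsSited volume (site (d := d)) (max N₁ (cubeVol d)) :=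
    isSited_volume.mono (le_max_right _ _) hN
  obtain ⟨L, hL, h3⟩ := h2.exists_eLpNorm_le hΦ hΦ
  refine ⟨L * (max N₁ (cubeVol d) * ∑' s, siteEnvelope Φ.envelope (-s)),
    ENNReal.mul_ne_top hL (ENNReal.mul_ne_top hN ?_), fun q hq c hc => ?_⟩
  · rw [tsum_comp_neg]; exact Φ.isAtoms.summable
  have hcb := enorm_le_of_eLpNorm_count c hq
  -- Expanding `e' γ` in the dual frame expresses the coefficients through the integrals of `synth
  -- Ψ.F c` against the `Φ.F γ'`. These make sense in every `L^q` and are bounded by the norm of the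
  -- function, not of `c`.
  have hcoef : ∀ γ, ∑' δ, inner ℂ (e' γ) (Ψ.vec δ) * c δ = ∑' γ', inner ℂ (e' γ) (e' γ') *
      ∫ x, synth Ψ.F c x * starRingEnd ℂ (Φ.F γ' x) := fun γ => by
    rw [tsum_congr fun γ' => congrArg _ (integral_synth_mul_conj Φ Ψ hN₂ hc hcb γ'),
      h2.tsum_mul_tsum (isConvDom_inner_vec Φ Ψ) hΦ hN₂ hc hcb]
    exact tsum_congr fun δ => congrArg (· * c δ)
      (hasSum_inner_mul_inner' (h1 (e' γ)) (Ψ.vec δ)).tsum_eq.symm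
  rw [funext hcoef, mul_assoc]
  refine (h3 q hq _).trans (mul_le_mul_right ?_ L)
  exact eLpNorm_integral_mul_conj_le Φ hΦ hE (Ψ.isAtoms.continuous_synth hN₂ hc hcb) hq

/-- Change of frame: `Q` is the projection of `ℓ^2` onto the range of the analysis operator of `Φ`,
and `U` maps the coefficients with respect to `Ψ` to coefficients with respect to `Φ`. -/
theorem exists_transition
    (hV : IsClosed (V : Set (Lp ℂ 2 (volume : Measure (EuclideanSpace ℝ (Fin d))))))
    (Φ Ψ : LocalizedFrame V) :
    ∃ (Q : Φ.nodes → Φ.nodes → ℂ) (U : Φ.nodes → Ψ.nodes → ℂ) (L : ℝ≥0∞), L ≠ ∞ ∧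
      IsConvDom Q Φ.nodeSite Φ.nodeSite ∧ IsConvDom U Φ.nodeSite Ψ.nodeSite ∧
      (∀ γ δ, ∑' γ', Q γ γ' * U γ' δ = U γ δ) ∧ (∀ x δ, ∑' γ, Φ.F γ x * U γ δ = Ψ.F δ x) ∧
      (∀ q : ℝ≥0∞, 1 ≤ q → ∀ c : Φ.nodes → ℂ, eLpNorm c q .count ≠ ∞ →
        eLpNorm (fun γ => ∑' γ', Q γ γ' * c γ') q .count ≤ L * eLpNorm (synth Φ.F c) q volume) ∧
      (∀ q : ℝ≥0∞, 1 ≤ q → ∀ c : Ψ.nodes → ℂ, eLpNorm c q .count ≠ ∞ →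
        eLpNorm (fun γ => ∑' δ, U γ δ * c δ) q .count ≤ L * eLpNorm (synth Ψ.F c) q volume) := by
  obtain ⟨e', h1, h2, h3⟩ := exists_dual hV Φ
  obtain ⟨L₁, hL₁, hQ⟩ := exists_eLpNorm_coeff_le Φ Φ h1 h2
  obtain ⟨L₂, hL₂, hU⟩ := exists_eLpNorm_coeff_le Φ Ψ h1 h2
  obtain ⟨N, hN⟩ := Φ.relativelySeparated.exists_isSited
  refine ⟨fun γ γ' => inner ℂ (e' γ) (Φ.vec γ'), fun γ δ => inner ℂ (e' γ) (Ψ.vec δ), max L₁ L₂,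
    max_ne_top hL₁ hL₂, h3 Φ, h3 Ψ, fun γ δ => ?_, fun x δ => ?_,
    fun q hq c hc => (hQ q hq c hc).trans (mul_le_mul_left (le_max_left _ _) _),
    fun q hq c hc => (hU q hq c hc).trans (mul_le_mul_left (le_max_right _ _) _)⟩
  · exact (hasSum_inner_mul_inner (h1 (Ψ.vec δ)) (e' γ)).tsum_eq
  · rw [eq_synth_of_hasSum_vec Φ Ψ δ (eLpNorm_column_ne_top (h3 Ψ) hN (by norm_num) δ)
      (h1 (Ψ.vec δ)), synth_eq]

end Transition

/-! ### Counting measure on a disjoint union of index sets. -/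

section SumIndex

variable {I J : Type*} [MeasurableSpace I] [MeasurableSingletonClass I] [Countable I]
  [MeasurableSpace J] [MeasurableSingletonClass J] [Countable J]

lemma eLpNorm_comp_le_of_injective {f : I → J} (hf : Function.Injective f) (g : J → ℂ)
    (p : ℝ≥0∞) : eLpNorm (fun i => g (f i)) p .count ≤ eLpNorm g p .count := by
  have hfm : Measurable f := measurable_of_countable f
  have h1 : Measure.map f .count ≤ .count := by
    refine Measure.le_iff.2 fun s hs => ?_
    rw [Measure.map_apply hfm hs, ← Measure.count_injective_image hf]
    exact measure_mono (Set.image_preimage_subset f s)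
  have h2 : eLpNorm (g ∘ f) p .count = eLpNorm g p (Measure.map f .count) :=
    (eLpNorm_map_measure (measurable_of_countable g).aestronglyMeasurable hfm.aemeasurable).symm
  exact h2.trans_le (eLpNorm_mono_measure g h1)

instance instMeasurableSingletonClassSum : MeasurableSingletonClass (I ⊕ J) := by
  refine ⟨fun x => measurableSet_sum_iff.2 ⟨?_, ?_⟩⟩
  · exact (Set.to_countable _).measurableSet
  · exact (Set.to_countable _).measurableSet

lemma IsSited.sumElim {G : Type*} [MeasurableSpace G] {πI : I → G} {πJ : J → G} {N N' : ℝ≥0∞}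
    (hI : IsSited .count πI N) (hJ : IsSited .count πJ N') :
    IsSited .count (Sum.elim πI πJ) (N + N') := by
  refine ⟨measurable_of_countable _, ENNReal.add_ne_top.2 ⟨hI.ne_top, hJ.ne_top⟩, fun s => ?_⟩
  have h : Sum.elim πI πJ ⁻¹' {s} ⊆ Sum.inl '' (πI ⁻¹' {s}) ∪ Sum.inr '' (πJ ⁻¹' {s}) := by
    rintro (i | j) h
    · exact Or.inl ⟨i, h, rfl⟩
    · exact Or.inr ⟨j, h, rfl⟩
  refine (measure_mono h).trans ((measure_union_le _ _).trans (add_le_add ?_ ?_))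
  · rw [Measure.count_injective_image Sum.inl_injective]; exact hI.le s
  · rw [Measure.count_injective_image Sum.inr_injective]; exact hJ.le s

end SumIndex

/-! ### Lower bounds on the range of a projection. -/

section Projection

variable {d : ℕ} {I J : Type*} [MeasurableSpace I] [MeasurableSingletonClass I] [Countable I]
  [MeasurableSpace J] [MeasurableSingletonClass J] [Countable J]
  {πI : I → Fin d → ℤ} {πJ : J → Fin d → ℤ} {N N' : ℝ≥0∞}

open Classical in
/-- The matrix with the blocks `1 - Q` and `S`. -/
noncomputable def stack {I J : Type*} (Q : I → I → ℂ) (S : J → I → ℂ) (l : I ⊕ J) (i : I) : ℂ :=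
  Sum.elim (fun k => (if k = i then 1 else 0) - Q k i) (fun j => S j i) l

/-- Write `c = (1 - Q) c + Q c`: the first summand is the first block, the second is controlled by
the second block. -/
lemma stack_isBoundedBelow {Q : I → I → ℂ} {S : J → I → ℂ} {p L : ℝ≥0∞} (hp : 1 ≤ p)
    (h : ∀ c : I → ℂ, eLpNorm c p .count ≠ ∞ → eLpNorm (fun i => ∑' k, Q i k * c k) p .count ≤
      L * eLpNorm (fun j => ∑' i, S j i * c i) p .count) :
    IsBoundedBelow (stack Q S) p (1 + L) := by
  classical
  intro s c hc
  have hcfin : eLpNorm c p .count ≠ ∞ := by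
    refine ne_top_of_le_ne_top ?_ (eLpNorm_count_le_tsum c hp)
    rw [tsum_eq_sum (s := s) (fun i hi => by simp [hc i hi])]
    exact ENNReal.sum_ne_top.2 fun i _ => by simp
  have h1 : ∀ k, ∑ i ∈ s, stack Q S (.inl k) i * c i = c k - ∑' i, Q k i * c i := fun k => by
    rw [tsum_eq_sum (s := s) (fun i hi => by simp [hc i hi])]
    simp only [stack, Sum.elim_inl, sub_mul, ite_mul, one_mul, zero_mul,
      Finset.sum_sub_distrib, Finset.sum_ite_eq]
    split_ifs with hk
    · rfl
    · rw [hc k hk]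
  have h2 : ∀ j, ∑ i ∈ s, stack Q S (.inr j) i * c i = ∑' i, S j i * c i := fun j => by
    rw [tsum_eq_sum (s := s) (fun i hi => by simp [hc i hi])]
    rfl
  have h3 : eLpNorm c p .count ≤ eLpNorm (fun k => ∑ i ∈ s, stack Q S (.inl k) i * c i) p .count +
      eLpNorm (fun k => ∑' i, Q k i * c i) p .count := by
    have : c = (fun k => ∑ i ∈ s, stack Q S (.inl k) i * c i) + fun k => ∑' i, Q k i * c i := by
      ext k; simp only [Pi.add_apply, h1, sub_add_cancel]
    calc eLpNorm c p .count = eLpNorm ((fun k => ∑ i ∈ s, stack Q S (.inl k) i * c i) +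
          fun k => ∑' i, Q k i * c i) p .count := by rw [← this]
      _ ≤ _ := eLpNorm_add_le (measurable_of_countable _).aestronglyMeasurable
        (measurable_of_countable _).aestronglyMeasurable hp
  refine h3.trans ?_
  rw [add_mul, one_mul]
  refine add_le_add (eLpNorm_comp_le_of_injective Sum.inl_injective
    (fun l => ∑ i ∈ s, stack Q S l i * c i) p)
    ((h c hcfin).trans (mul_le_mul_right ?_ L))
  simp_rw [← h2]
  exact eLpNorm_comp_le_of_injective Sum.inr_injective (fun l => ∑ i ∈ s, stack Q S l i * c i) p

/-- Stability of convolution-dominated matrices that are bounded below on the range of a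
convolution-dominated matrix `Q`. -/
theorem exists_enorm_le_tsum_of_projection (hI : IsSited .count πI N) (hJ : IsSited .count πJ N')
    {Q : I → I → ℂ} {S : J → I → ℂ} (hQ : IsConvDom Q πI πI) (hS : IsConvDom S πJ πI)
    {p L : ℝ≥0∞} (hp : 1 ≤ p) (hL : L ≠ ∞)
    (h : ∀ c : I → ℂ, eLpNorm c p .count ≠ ∞ → eLpNorm (fun i => ∑' k, Q i k * c k) p .count ≤
      L * eLpNorm (fun j => ∑' i, S j i * c i) p .count) :
    ∃ w : (Fin d → ℤ) → ℝ≥0∞, ∑' s, w s ≠ ∞ ∧ ∀ (c : I → ℂ) (K : ℝ≥0∞), K ≠ ∞ →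
      (∀ i, ‖c i‖ₑ ≤ K) → (∀ i, ∑' k, Q i k * c k = c i) → ∀ i,
      ‖c i‖ₑ ≤ ∑' j, w (πI i - πJ j) * ‖∑' i, S j i * c i‖ₑ := by
  classical
  have hIJ := hI.sumElim hJ
  have hI' : IsSited .count πI (N + N') := hI.mono le_self_add hIJ.ne_top
  obtain ⟨v, hv, hMv⟩ : IsConvDom (stack Q S) (Sum.elim πI πJ) πI :=
    (isConvDom_one.sub hQ).sumElim hS
  obtain ⟨w, hw, H⟩ := enorm_le_tsum_of_isBoundedBelow hv hI' hIJ hp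
    (ENNReal.add_ne_top.2 ⟨ENNReal.one_ne_top, hL⟩)
  refine ⟨w, hw, fun c K hK hcK hQc i => ?_⟩
  refine (H (stack Q S) hMv (stack_isBoundedBelow hp h) c K hK hcK i).trans ?_
  -- On vectors fixed by `Q` the first block vanishes, so only the rows of `S` remain in the
  -- estimate.
  have hr : ∀ k, ∑' i, stack Q S (.inl k) i * c i = 0 := fun k => by
    simp only [stack, Sum.elim_inl, sub_mul, ite_mul, one_mul, zero_mul]
    have h1 : HasSum (fun i => if k = i then c i else 0) (c k) := by
      simpa using hasSum_single (f := fun i => if k = i then c i else 0) k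
        fun i hi => if_neg hi.symm
    have h2 := h1.sub (hQ.summable_mul hI hK hcK k).hasSum
    rw [h2.tsum_eq, hQc, sub_self]
  rw [ENNReal.summable.tsum_sum ENNReal.summable]
  simp only [hr, enorm_zero, mul_zero, tsum_zero, zero_add]
  exact le_rfl

end Projection

/-! ### Transfer of the sampling property. -/

section Sampling

variable {d : ℕ} {V : Submodule ℂ (Lp ℂ 2 (volume : Measure (EuclideanSpace ℝ (Fin d))))}
  {Λ : Set (EuclideanSpace ℝ (Fin d))}

lemma isSamplingSet_of_le [Countable Λ] {W : Set (EuclideanSpace ℝ (Fin d) → ℂ)} {p : ℝ≥0∞}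
    (hp : 1 ≤ p) {K L : ℝ≥0∞} (hK : K ≠ ∞) (hL : L ≠ ∞) (hW : ∀ f ∈ W, MemLp f p volume)
    (h1 : ∀ f ∈ W, eLpNorm f p volume ≤ K * eLpNorm (fun l : Λ => f l) p .count)
    (h2 : ∀ f ∈ W, eLpNorm (fun l : Λ => f l) p .count ≤ L * eLpNorm f p volume) :
    IsSamplingSet W p Λ := by
  -- Adding one keeps the constants positive when `K` or `L` is zero.
  refine ⟨(K.toReal + 1)⁻¹, L.toReal + 1, by positivity, by positivity, fun f hf => ?_⟩
  have hf1 := (hW f hf).2.ne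
  have hf2 : eLpNorm (fun l : Λ => f l) p .count ≠ ∞ :=
    ne_top_of_le_ne_top (ENNReal.mul_ne_top hL hf1) (h2 f hf)
  refine ⟨⟨fun l => f l, (memℓp_iff_eLpNorm_count hp _).2 hf2⟩, fun l => rfl, ?_, ?_⟩
  · rw [norm_lp_eq hp, inv_mul_le_iff₀ (by positivity)]
    have := ENNReal.toReal_mono (ENNReal.mul_ne_top hK hf2) (h1 f hf)
    rw [ENNReal.toReal_mul] at this
    refine this.trans ?_
    gcongr
    linarith
  · rw [norm_lp_eq hp]
    have := ENNReal.toReal_mono (ENNReal.mul_ne_top hL hf1) (h2 f hf)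
    rw [ENNReal.toReal_mul] at this
    refine this.trans ?_
    gcongr
    linarith

lemma _root_.IsSamplingSet.exists_le [Countable Λ] {W : Set (EuclideanSpace ℝ (Fin d) → ℂ)} {p : ℝ≥0∞}
    (hp : 1 ≤ p) (h : IsSamplingSet W p Λ) (hW : ∀ f ∈ W, MemLp f p volume) :
    ∃ K : ℝ≥0∞, K ≠ ∞ ∧ ∀ f ∈ W,
      eLpNorm f p volume ≤ K * eLpNorm (fun l : Λ => f l) p .count := by
  obtain ⟨A, B, hA, -, h⟩ := h
  refine ⟨ENNReal.ofReal A⁻¹, ENNReal.ofReal_ne_top, fun f hf => ?_⟩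
  obtain ⟨a, ha, h1, -⟩ := h f hf
  have hfa : (fun l : Λ => f l) = a := funext fun l => (ha l).symm
  have ha' := (memℓp_iff_eLpNorm_count hp a).1 (lp.memℓp a)
  rw [hfa, ← ENNReal.ofReal_toReal ha', ← norm_lp_eq hp, ← ENNReal.ofReal_mul (by positivity),
    ← ENNReal.ofReal_toReal (hW f hf).2.ne]
  refine ENNReal.ofReal_le_ofReal ?_
  rwa [inv_mul_eq_div, le_div_iff₀ hA, mul_comm]

lemma synth_tsum_transition {Φ Ψ : LocalizedFrame V} {U : Φ.nodes → Ψ.nodes → ℂ}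
    (hU : IsConvDom U Φ.nodeSite Ψ.nodeSite) (h : ∀ x δ, ∑' γ, Φ.F γ x * U γ δ = Ψ.F δ x)
    {c : Ψ.nodes → ℂ} {K : ℝ≥0∞} (hK : K ≠ ∞) (hcK : ∀ δ, ‖c δ‖ₑ ≤ K) :
    synth Φ.F (fun γ => ∑' δ, U γ δ * c δ) = synth Ψ.F c := by
  obtain ⟨N₁, hN₁⟩ := Φ.relativelySeparated.exists_isSited
  obtain ⟨N₂, hN₂⟩ := Ψ.relativelySeparated.exists_isSited
  ext x
  rw [synth_eq, synth_eq]
  refine ((Φ.isAtoms.isConvDom id).tsum_mul_tsum hU hN₁ hN₂ hK hcK x).trans ?_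
  exact tsum_congr fun δ => by rw [← h]; rfl

/-- The reconstruction of frame coefficients from samples. -/
lemma exists_coeff_le_of_isSamplingSet (Φ : LocalizedFrame V) (hΛ : RelativelySeparated Λ)
    {Q : Φ.nodes → Φ.nodes → ℂ} (hQ : IsConvDom Q Φ.nodeSite Φ.nodeSite) {L : ℝ≥0∞} (hL : L ≠ ∞)
    {p : ℝ≥0∞} (hp : 1 ≤ p)
    (hQL : ∀ c : Φ.nodes → ℂ, eLpNorm c p .count ≠ ∞ →
        eLpNorm (fun γ => ∑' γ', Q γ γ' * c γ') p .count ≤ L * eLpNorm (synth Φ.F c) p volume)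
    (h : IsSamplingSet (Φ.rangeSpace p) p Λ) :
    ∃ w : (Fin d → ℤ) → ℝ≥0∞, ∑' s, w s ≠ ∞ ∧ ∀ (c : Φ.nodes → ℂ) (K : ℝ≥0∞), K ≠ ∞ →
      (∀ γ, ‖c γ‖ₑ ≤ K) → (∀ γ, ∑' γ', Q γ γ' * c γ' = c γ) → ∀ γ,
      ‖c γ‖ₑ ≤ ∑' l : Λ, w (Φ.nodeSite γ - site (l : EuclideanSpace ℝ (Fin d))) *
        ‖synth Φ.F c l‖ₑ := by
  have hcΦ := Φ.relativelySeparated.countable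
  have hcΛ := hΛ.countable
  obtain ⟨N₁, hN₁⟩ := Φ.relativelySeparated.exists_isSited
  obtain ⟨N₂, hN₂⟩ := hΛ.exists_isSited
  obtain ⟨B, hB, hB'⟩ := IsSamplingSet.exists_le hp h fun f hf => hf.2.1
  obtain ⟨w, hw, H⟩ := exists_enorm_le_tsum_of_projection (πI := Φ.nodeSite) hN₁ hN₂ hQ
    (Φ.isAtoms.isConvDom fun l : Λ => (l : EuclideanSpace ℝ (Fin d))) hp
    (ENNReal.mul_ne_top hL hB) fun c hc => by
      refine (hQL c hc).trans ?_
      rw [mul_assoc]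
      refine mul_le_mul_right ?_ L
      have h3 := hB' (synth Φ.F c) ((mem_rangeSpace_iff Φ hp _).2 ⟨c, hc, rfl⟩)
      simpa only [← synth_eq] using h3
  exact ⟨w, hw, fun c K hK hcK hQc γ => by simpa only [← synth_eq] using H c K hK hcK hQc γ⟩

theorem _root_.IsSamplingSet.rangeSpace
    (hV : IsClosed (V : Set (Lp ℂ 2 (volume : Measure (EuclideanSpace ℝ (Fin d))))))
    {Φ : LocalizedFrame V} (Ψ : LocalizedFrame V) (hΛ : RelativelySeparated Λ) {p q : ℝ≥0∞}
    (hp : 1 ≤ p) (hq : 1 ≤ q) (h : IsSamplingSet (Φ.rangeSpace p) p Λ) :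
    IsSamplingSet (Ψ.rangeSpace q) q Λ := by
  have hcΦ := Φ.relativelySeparated.countable
  have hcΨ := Ψ.relativelySeparated.countable
  have hcΛ := hΛ.countable
  obtain ⟨Q, U, L, hL, hQ, hU, hQU, hFU, hQL, hUL⟩ := exists_transition hV Φ Ψ
  obtain ⟨w, hw, H⟩ := exists_coeff_le_of_isSamplingSet Φ hΛ hQ hL hp (hQL p hp) h
  obtain ⟨N₁, hN₁⟩ := Φ.relativelySeparated.exists_isSited
  obtain ⟨N₂, hN₂⟩ := Ψ.relativelySeparated.exists_isSited
  obtain ⟨N₃, hN₃⟩ := hΛ.exists_isSited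
  have hN : max (max N₁ N₃) (cubeVol d) ≠ ∞ :=
    max_ne_top (max_ne_top hN₁.ne_top hN₃.ne_top) cubeVol_ne_top
  have hΦ : IsSited .count Φ.nodeSite (max (max N₁ N₃) (cubeVol d)) :=
    hN₁.mono ((le_max_left _ _).trans (le_max_left _ _)) hN
  have hΛ' := hN₃.mono ((le_max_right N₁ N₃).trans (le_max_left _ (cubeVol d))) hN
  have hE : IsSited volume (site (d := d)) (max (max N₁ N₃) (cubeVol d)) :=
    isSited_volume.mono (le_max_right _ _) hN
  generalize max (max N₁ N₃) (cubeVol d) = N at hN hΦ hΛ' hE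
  have hS := Φ.isAtoms.summable
  -- Every `f` is re-expanded in `Φ` with coefficients fixed by `Q`. Their `ℓ^q` norm is bounded by
  -- `‖f‖_q` and, through the reconstruction kernel, by the samples; the two sampling inequalities
  -- follow from boundedness of evaluation and of synthesis respectively.
  have main : ∀ f ∈ Ψ.rangeSpace q, ∃ c : Φ.nodes → ℂ, f = synth Φ.F c ∧
      eLpNorm c q .count ≤ L * eLpNorm f q volume ∧
      eLpNorm c q .count ≤ N * (∑' s, w s) * eLpNorm (fun l : Λ => f l) q .count := by
    intro f hf
    have hf2 := hf.2.1
    obtain ⟨a, ha, rfl⟩ := (mem_rangeSpace_iff Ψ hq f).1 hf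
    have hab := enorm_le_of_eLpNorm_count a hq
    have hfc := synth_tsum_transition hU hFU ha hab
    have hcL := hUL q hq a ha
    set c : Φ.nodes → ℂ := fun γ => ∑' δ, U γ δ * a δ with hc
    have hcfin : eLpNorm c q .count ≠ ∞ :=
      ne_top_of_le_ne_top (ENNReal.mul_ne_top hL hf2.2.ne) hcL
    have hQc : ∀ γ, ∑' γ', Q γ γ' * c γ' = c γ := fun γ => by
      rw [hc, hQ.tsum_mul_tsum hU hΦ hN₂ ha hab γ]
      exact tsum_congr fun δ => by rw [hQU]
    refine ⟨c, hfc.symm, hcL, ?_⟩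
    rw [← hfc, ← eLpNorm_enorm (fun l : Λ => synth Φ.F c l)]
    refine le_trans (eLpNorm_mono_enorm fun γ => ?_)
      (eLpNorm_lintegral_conv_le hΦ hΛ' hw (measurable_of_countable _) hq)
    rw [enorm_eq_self, lintegral_count]
    exact H c _ hcfin (enorm_le_of_eLpNorm_count c hq) hQc γ
  refine isSamplingSet_of_le hq
    (K := N * (∑' s, siteEnvelope Φ.envelope s) * (N * (∑' s, w s)))
    (L := N * (∑' s, siteEnvelope Φ.envelope s) * L)
    (ENNReal.mul_ne_top (ENNReal.mul_ne_top hN hS) (ENNReal.mul_ne_top hN hw))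
    (ENNReal.mul_ne_top (ENNReal.mul_ne_top hN hS) hL) (fun f hf => hf.2.1)
    (fun f hf => ?_) (fun f hf => ?_)
  · obtain ⟨c, hfc, -, h2⟩ := main f hf
    rw [mul_assoc]
    refine le_trans ?_ (mul_le_mul_right h2 _)
    rw [hfc]
    exact Φ.isAtoms.eLpNorm_synth_le hΦ hE c hq
  · obtain ⟨c, hfc, h1, -⟩ := main f hf
    rw [mul_assoc]
    refine le_trans ?_ (mul_le_mul_right h1 _)
    rw [hfc]
    exact Φ.isAtoms.eLpNorm_synth_comp_le hΦ hΛ' c hq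

end Sampling

/-! ### Extremal vectors for Hölder's inequality. -/

section Norming

variable {J : Type*} [MeasurableSpace J] [MeasurableSingletonClass J]

/-- Finite support makes the extremum attained at both end points too: by the constant weight if `p
= ∞`, by a point mass at a largest entry if `p = 1`. Hence the full dual of `ℓ^∞` is never needed.
-/
lemma exists_norming_weight {p p' : ℝ≥0∞} (hpp : p.HolderConjugate p') (s : Finset J) (b : J → ℂ)
    (hb : ∀ j ∉ s, b j = 0) :
    ∃ g : J → NNReal, eLpNorm (fun j => (g j : ℝ≥0∞)) p .count ≤ 1 ∧
      eLpNorm b p' .count ≤ ∑ j ∈ s, ‖b j‖ₑ * g j := by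
  classical
  rcases eq_or_ne p ∞ with rfl | hpt
  · obtain rfl : p' = 1 := (ENNReal.HolderConjugate.eq_top_iff_eq_one ∞ p').1 rfl
    refine ⟨1, ?_, ?_⟩
    · rw [eLpNorm_exponent_top, eLpNormEssSup_count]
      simp
    · rw [eLpNorm_one_eq_lintegral_enorm, lintegral_count,
        tsum_eq_sum (s := s) fun j hj => by simp [hb j hj]]
      simp
  rcases eq_or_ne p' ∞ with rfl | hpt'
  · obtain rfl : p = 1 := (ENNReal.HolderConjugate.eq_top_iff_eq_one ∞ p).1 rfl
    rcases s.eq_empty_or_nonempty with rfl | hs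
    · refine ⟨0, by simp, ?_⟩
      rw [show b = 0 from funext fun j => hb j (by simp)]
      simp
    obtain ⟨k, hk, hmax⟩ := s.exists_max_image (fun j => ‖b j‖ₑ) hs
    refine ⟨Pi.single k 1, ?_, ?_⟩
    · rw [eLpNorm_one_eq_lintegral_enorm, lintegral_count,
        tsum_eq_single k fun j hj => by simp [hj]]
      simp
    · rw [eLpNorm_exponent_top, eLpNormEssSup_count]
      refine iSup_le fun j => le_trans ?_ (Finset.single_le_sum
        (f := fun j => ‖b j‖ₑ * ((Pi.single k 1 : J → NNReal) j : ℝ≥0∞)) (fun _ _ => zero_le) hk)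
      simp only [Pi.single_eq_same, ENNReal.coe_one, mul_one]
      by_cases hj : j ∈ s
      · exact hmax j hj
      · simp [hb j hj]
  have hq := ENNReal.HolderConjugate.toReal_of_ne_top hpt hpt'
  obtain ⟨g, hg, hgeq⟩ := (NNReal.isGreatest_Lp s (fun j => ‖b j‖₊) hq.symm).1
  have hp0 : p ≠ 0 := fun h => hq.ne_zero (by simp [h])
  have hp0' : p' ≠ 0 := fun h => hq.symm.ne_zero (by simp [h])
  refine ⟨fun j => if j ∈ s then g j else 0, ?_, ?_⟩
  · rw [eLpNorm_eq_lintegral_rpow_enorm_toReal hp0 hpt, lintegral_count,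
      tsum_eq_sum (s := s) fun j hj => by simp [hj, hq.pos],
      Finset.sum_congr (g := fun j => ((g j ^ p.toReal : NNReal) : ℝ≥0∞)) rfl fun j hj => by
        simp only [if_pos hj, enorm_eq_self, ENNReal.coe_rpow_of_nonneg _ hq.nonneg]]
    refine ENNReal.rpow_le_one ?_ (by positivity)
    exact_mod_cast hg
  · rw [eLpNorm_eq_lintegral_rpow_enorm_toReal hp0' hpt', lintegral_count,
      tsum_eq_sum (s := s) fun j hj => by simp [hb j hj, hq.symm.pos],
      Finset.sum_congr (f := fun j => ‖b j‖ₑ * ((if j ∈ s then g j else 0 : NNReal) : ℝ≥0∞))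
        (g := fun j => ‖b j‖ₑ * (g j : ℝ≥0∞)) rfl fun j hj => by rw [if_pos hj]]
    have h1 := congrArg (fun x : NNReal => (x : ℝ≥0∞)) hgeq
    simp only [ENNReal.ofNNReal_finsetSum, ENNReal.coe_mul] at h1
    refine le_of_eq (Eq.trans ?_ h1.symm)
    rw [ENNReal.coe_rpow_of_nonneg _ (by positivity), ENNReal.ofNNReal_finsetSum]
    simp_rw [ENNReal.coe_rpow_of_nonneg _ hq.symm.nonneg]
    rfl

/-- Finitely supported sequences are normed by finitely supported sequences in the dual space. -/
lemma exists_norming {p p' : ℝ≥0∞} (hpp : p.HolderConjugate p') (s : Finset J) (b : J → ℂ)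
    (hb : ∀ j ∉ s, b j = 0) :
    ∃ a : J → ℂ, eLpNorm a p .count ≤ 1 ∧
      eLpNorm b p' .count ≤ ‖∑ j ∈ s, b j * a j‖ₑ := by
  obtain ⟨g, hg1, hg2⟩ := exists_norming_weight hpp s b hb
  have hphase : ∀ z : ℂ, ∃ u : ℂ, ‖u‖ ≤ 1 ∧ z * u = ‖z‖ := fun z => by
    rcases eq_or_ne z 0 with rfl | hz
    · exact ⟨0, by simp, by simp⟩
    · have hz' : (‖z‖ : ℂ) ≠ 0 := by exact_mod_cast norm_ne_zero_iff.2 hz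
      refine ⟨starRingEnd ℂ z / ‖z‖, ?_, ?_⟩
      · rw [norm_div, RCLike.norm_conj, Complex.norm_real, norm_norm]
        exact div_self_le_one _
      · rw [← mul_div_assoc, Complex.mul_conj', sq, mul_div_assoc, div_self hz', mul_one]
  choose u hu1 hu2 using hphase
  refine ⟨fun j => g j * u (b j), le_trans (eLpNorm_mono_enorm fun j => ?_) hg1,
    hg2.trans_eq ?_⟩
  · rw [enorm_mul]
    have h1 : ‖((g j : ℝ) : ℂ)‖ₑ = ‖(g j : ℝ≥0∞)‖ₑ := by
      rw [← ofReal_norm, Complex.norm_real]; simp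
    have h2 : ‖u (b j)‖ₑ ≤ 1 := by
      rw [← ofReal_norm, ENNReal.ofReal_le_one]; exact hu1 _
    calc _ ≤ ‖(g j : ℝ≥0∞)‖ₑ * 1 := mul_le_mul' h1.le h2
      _ = _ := mul_one _
  · have h1 : ∀ j, b j * (g j * u (b j)) = ((‖b j‖₊ * g j : NNReal) : ℝ) := fun j => by
      rw [mul_left_comm, hu2]; push_cast; rw [mul_comm]
    simp_rw [h1]
    rw [← Complex.ofReal_sum, ← NNReal.coe_sum, ← ofReal_norm, Complex.norm_real]
    rw [Real.norm_of_nonneg (NNReal.coe_nonneg _), ENNReal.ofReal_coe_nnreal]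
    rw [ENNReal.ofNNReal_finsetSum]
    rfl

end Norming

/-! ### From surjectivity to a lower bound for the transpose. -/

section OpenMapping

variable {d : ℕ} {I J : Type*} [MeasurableSpace I] [MeasurableSingletonClass I] [Countable I]
  [MeasurableSpace J] [MeasurableSingletonClass J] [Countable J]
  {πI : I → Fin d → ℤ} {πJ : J → Fin d → ℤ} {N : ℝ≥0∞}

/-- The open mapping theorem, applied to the bounded operator that the matrix induces on `ℓ^p`. -/
lemma exists_preimage_eLpNorm_le (hI : IsSited .count πI N) (hJ : IsSited .count πJ N)
    {S : J → I → ℂ} (hS : IsConvDom S πJ πI) {p : ℝ≥0∞} (hp : 1 ≤ p)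
    (h : ∀ a : J → ℂ, eLpNorm a p .count ≠ ∞ →
      ∃ c : I → ℂ, eLpNorm c p .count ≠ ∞ ∧ ∀ j, ∑' i, S j i * c i = a j) :
    ∃ C : ℝ≥0∞, C ≠ ∞ ∧ ∀ a : J → ℂ, eLpNorm a p .count ≠ ∞ →
      ∃ c : I → ℂ, (∀ j, ∑' i, S j i * c i = a j) ∧
        eLpNorm c p .count ≤ C * eLpNorm a p .count := by
  have : Fact (1 ≤ p) := ⟨hp⟩
  obtain ⟨L, hL, hSL⟩ := hS.exists_eLpNorm_le hI hJ
  have hfin : ∀ {K : Type _} [MeasurableSpace K] [MeasurableSingletonClass K]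
      (c : lp (fun _ : K => ℂ) p), eLpNorm c p .count ≠ ∞ := fun c =>
    (memℓp_iff_eLpNorm_count hp c).1 (lp.memℓp c)
  have hfinJ : ∀ (c : lp (fun _ : J => ℂ) p), eLpNorm c p .count ≠ ∞ := fun c =>
    (memℓp_iff_eLpNorm_count hp c).1 (lp.memℓp c)
  have hsum : ∀ (c : lp (fun _ : I => ℂ) p) (j : J), Summable fun i => S j i * c i := fun c j =>
    hS.summable_mul hI (hfin c) (enorm_le_of_eLpNorm_count c hp) j
  let T : lp (fun _ : I => ℂ) p →ₗ[ℂ] lp (fun _ : J => ℂ) p :=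
    { toFun := fun c => ⟨fun j => ∑' i, S j i * c i, (memℓp_iff_eLpNorm_count hp _).2
        (ne_top_of_le_ne_top (ENNReal.mul_ne_top hL (hfin c)) (hSL p hp c))⟩
      map_add' := fun c c' => by
        ext j
        change ∑' i, S j i * (c i + c' i) = ∑' i, S j i * c i + ∑' i, S j i * c' i
        simp_rw [mul_add]
        exact (hsum c j).tsum_add (hsum c' j)
      map_smul' := fun z c => by
        ext j
        change ∑' i, S j i * (z * c i) = z * ∑' i, S j i * c i
        rw [← tsum_mul_left]
        exact tsum_congr fun i => by ring }
  have hT : ∀ c j, T c j = ∑' i, S j i * c i := fun c j => rfl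
  let T' := T.mkContinuous L.toReal fun c => by
    rw [norm_lp_eq hp, norm_lp_eq hp, ← ENNReal.toReal_mul]
    exact ENNReal.toReal_mono (ENNReal.mul_ne_top hL (hfin c)) (hSL p hp c)
  have hsurj : Function.Surjective T' := fun a => by
    obtain ⟨c, hc, hca⟩ := h a (hfinJ a)
    exact ⟨⟨c, (memℓp_iff_eLpNorm_count hp c).2 hc⟩, lp.ext (funext hca)⟩
  obtain ⟨C, hC, H⟩ := T'.exists_preimage_norm_le hsurj
  refine ⟨ENNReal.ofReal C, ENNReal.ofReal_ne_top, fun a ha => ?_⟩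
  obtain ⟨c, hca, hcC⟩ := H ⟨a, (memℓp_iff_eLpNorm_count hp a).2 ha⟩
  refine ⟨c, fun j => ?_, ?_⟩
  · exact congrFun (congrArg (fun x : lp (fun _ : J => ℂ) p => (x : J → ℂ)) hca) j
  · rw [norm_lp_eq hp, norm_lp_eq hp] at hcC
    rw [← ENNReal.ofReal_toReal (hfin c), ← ENNReal.ofReal_toReal ha,
      ← ENNReal.ofReal_mul hC.le]
    exact ENNReal.ofReal_le_ofReal hcC

/-- The transpose of a surjective operator is bounded below. -/
lemma isBoundedBelow_transpose (hI : IsSited .count πI N) {S : J → I → ℂ}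
    (hS : IsConvDom S πJ πI) {p p' : ℝ≥0∞} (hp : 1 ≤ p) (hpp : p.HolderConjugate p') {C : ℝ≥0∞}
    (hC : C ≠ ∞)
    (h : ∀ a : J → ℂ, eLpNorm a p .count ≠ ∞ → ∃ c : I → ℂ, (∀ j, ∑' i, S j i * c i = a j) ∧
        eLpNorm c p .count ≤ C * eLpNorm a p .count) :
    IsBoundedBelow (fun i j => S j i) p' C := by
  intro s b hb
  obtain ⟨a, ha1, ha2⟩ := exists_norming hpp s b hb
  have ha : eLpNorm a p .count ≠ ∞ := ne_top_of_le_ne_top ENNReal.one_ne_top ha1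
  obtain ⟨c, hca, hcC⟩ := h a ha
  have hcC' : eLpNorm c p .count ≤ C := hcC.trans ((mul_le_mul_right ha1 C).trans_eq (mul_one C))
  have hc : eLpNorm c p .count ≠ ∞ := ne_top_of_le_ne_top hC hcC'
  have hsum := hS.summable_mul hI hc (enorm_le_of_eLpNorm_count c hp)
  -- With `a = S c`, the pairing of `b` with `a` is the pairing of the transpose applied to `b` with
  -- `c`; Hölder then finishes.
  have h1 : ∑ j ∈ s, b j * a j = ∑' i, (∑ j ∈ s, S j i * b j) * c i := by
    simp_rw [← hca, ← tsum_mul_left]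
    rw [← Summable.tsum_finsetSum fun j _ => (hsum j).mul_left _]
    refine tsum_congr fun i => ?_
    rw [Finset.sum_mul]
    exact Finset.sum_congr rfl fun j _ => by ring
  have hpp' : p'.HolderConjugate p := hpp.symm
  calc eLpNorm b p' .count ≤ ‖∑' i, (∑ j ∈ s, S j i * b j) * c i‖ₑ := h1 ▸ ha2
    _ ≤ ∑' i, ‖(∑ j ∈ s, S j i * b j) * c i‖ₑ := enorm_tsum_le_tsum_enorm
    _ = eLpNorm ((fun i => ∑ j ∈ s, S j i * b j) • c) 1 .count := by
        rw [eLpNorm_one_eq_lintegral_enorm, lintegral_count]; rfl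
    _ ≤ eLpNorm (fun i => ∑ j ∈ s, S j i * b j) p' .count * eLpNorm c p .count :=
        eLpNorm_smul_le_mul_eLpNorm (measurable_of_countable _).aestronglyMeasurable
          (measurable_of_countable _).aestronglyMeasurable
    _ ≤ eLpNorm (fun i => ∑ j ∈ s, S j i * b j) p' .count * C := mul_le_mul_right hcC' _
    _ = _ := mul_comm _ _

end OpenMapping

/-! ### Convolution-dominated right inverses. -/

section RightInverse

lemma exists_isHilbertFrame_of_enorm_le {H : Type*} [NormedAddCommGroup H] [InnerProductSpace ℂ H]
    {I : Type*} [MeasurableSpace I] [MeasurableSingletonClass I] {e : I → H} {K L : ℝ≥0∞}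
    (hK : K ≠ ∞) (hL : L ≠ ∞)
    (h1 : ∀ f, ‖f‖ₑ ≤ K * eLpNorm (fun i => inner ℂ (e i) f) 2 .count)
    (h2 : ∀ f, eLpNorm (fun i => inner ℂ (e i) f) 2 .count ≤ L * ‖f‖ₑ) :
    ∃ A B, IsHilbertFrame e A B := by
  have hfin : ∀ f, eLpNorm (fun i => inner ℂ (e i) f) 2 .count ≠ ∞ := fun f =>
    ne_top_of_le_ne_top (ENNReal.mul_ne_top hL enorm_ne_top) (h2 f)
  have hmem : ∀ f, Memℓp (fun i => inner ℂ (e i) f) 2 := fun f =>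
    (memℓp_iff_eLpNorm_count (by norm_num) _).2 (hfin f)
  have hsq : ∀ f, ∑' i, ‖inner ℂ (e i) f‖ ^ 2 =
      (eLpNorm (fun i => inner ℂ (e i) f) 2 .count).toReal ^ 2 := fun f => by
    have := lp.norm_rpow_eq_tsum (p := 2) (by simp) ⟨_, hmem f⟩
    rw [norm_lp_eq (by norm_num)] at this
    simpa using this.symm
  refine ⟨((K.toReal + 1) ^ 2)⁻¹, L.toReal ^ 2, by positivity, fun f => ?_, fun f => ?_,
    fun f => ?_⟩
  · simpa using (memℓp_gen_iff (by simp)).1 (hmem f)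
  · have h := ENNReal.toReal_mono (ENNReal.mul_ne_top hK (hfin f)) (h1 f)
    rw [ENNReal.toReal_mul, toReal_enorm] at h
    rw [hsq, inv_mul_le_iff₀ (by positivity), ← mul_pow]
    gcongr
    refine h.trans ?_
    gcongr
    linarith
  · have h := ENNReal.toReal_mono (ENNReal.mul_ne_top hL enorm_ne_top) (h2 f)
    rw [ENNReal.toReal_mul, toReal_enorm] at h
    rw [hsq, ← mul_pow]
    gcongr

variable {d : ℕ} {I J : Type} [MeasurableSpace I] [MeasurableSingletonClass I] [Countable I]
  [MeasurableSpace J] [MeasurableSingletonClass J] [Countable J]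
  {πI : I → Fin d → ℤ} {πJ : J → Fin d → ℤ} {N : ℝ≥0∞}

lemma exists_eLpNorm_le_transpose (hI : IsSited .count πI N) (hJ : IsSited .count πJ N)
    {S : J → I → ℂ} (hS : IsConvDom S πJ πI) {p C : ℝ≥0∞} (hp : 1 ≤ p) (hC : C ≠ ∞)
    (h : IsBoundedBelow (fun i j => S j i) p C) :
    ∃ L : ℝ≥0∞, L ≠ ∞ ∧ ∀ q : ℝ≥0∞, 1 ≤ q → ∀ b : J → ℂ, eLpNorm b q .count ≠ ∞ →
      eLpNorm b q .count ≤ L * eLpNorm (fun i => ∑' j, S j i * b j) q .count := by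
  obtain ⟨v, hv, hSv⟩ := hS.of_enorm_le_transpose (B := fun i j => S j i) fun _ _ => le_rfl
  obtain ⟨w, hw, H⟩ := enorm_le_tsum_of_isBoundedBelow hv hJ hI hp hC
  refine ⟨N * ∑' s, w s, ENNReal.mul_ne_top hI.ne_top hw, fun q hq b hb => ?_⟩
  rw [← eLpNorm_enorm (fun i => ∑' j, S j i * b j)]
  refine le_trans (eLpNorm_mono_enorm fun j => ?_)
    (eLpNorm_lintegral_conv_le hJ hI hw (measurable_of_countable _) hq)
  rw [enorm_eq_self, lintegral_count]
  exact H (fun i j => S j i) hSv h b _ hb (enorm_le_of_eLpNorm_count b hq) j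

open Classical in
/-- A convolution-dominated matrix whose transpose is bounded below has a convolution-dominated
right inverse. -/
theorem exists_right_inverse (hI : IsSited .count πI N) (hJ : IsSited .count πJ N)
    {S : J → I → ℂ} (hS : IsConvDom S πJ πI) {p C : ℝ≥0∞} (hp : 1 ≤ p) (hC : C ≠ ∞)
    (h : IsBoundedBelow (fun i j => S j i) p C) :
    ∃ R : I → J → ℂ, IsConvDom R πI πJ ∧
      ∀ j j', ∑' i, S j i * R i j' = if j = j' then 1 else 0 := by
  have hT : IsConvDom (fun i j => S j i) πI πJ := hS.of_enorm_le_transpose fun _ _ => le_rfl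
  obtain ⟨K, hK, hlow⟩ := exists_eLpNorm_le_transpose hI hJ hS hp hC h
  obtain ⟨L, hL, hup⟩ := hT.exists_eLpNorm_le hJ hI
  have h12 : (1 : ℝ≥0∞) ≤ 2 := by norm_num
  let e : I → lp (fun _ : J => ℂ) 2 := fun i =>
    ⟨fun j => S j i, (memℓp_iff_eLpNorm_count h12 _).2 (eLpNorm_column_ne_top hS hJ h12 i)⟩
  have he : ∀ i j, e i j = S j i := fun i j => rfl
  clear_value e
  have hinner : ∀ i f, ‖inner ℂ (e i) f‖ₑ = ‖∑' j, S j i * starRingEnd ℂ (f j)‖ₑ := fun i f => by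
    rw [← RCLike.enorm_conj, inner_conj_symm, lp.inner_eq_tsum]
    simp only [RCLike.inner_apply, he]
  have hnorm : ∀ f : lp (fun _ : J => ℂ) 2,
      ‖f‖ₑ = eLpNorm (fun j => starRingEnd ℂ (f j)) 2 .count := fun f => by
    have h1 : eLpNorm (fun j => starRingEnd ℂ (f j)) 2 .count = eLpNorm f 2 .count :=
      eLpNorm_congr_enorm_ae (Eventually.of_forall fun j => by simp)
    rw [h1, ← ofReal_norm, norm_lp_eq h12, ENNReal.ofReal_toReal]
    exact (memℓp_iff_eLpNorm_count h12 _).1 (lp.memℓp f)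
  have hcoef : ∀ f, eLpNorm (fun i => inner ℂ (e i) f) 2 .count =
      eLpNorm (fun i => ∑' j, S j i * starRingEnd ℂ (f j)) 2 .count := fun f =>
    eLpNorm_congr_enorm_ae (Eventually.of_forall fun i => hinner i f)
  -- The columns of `S`, as vectors of `ℓ^2(J)`, form a frame: up to conjugation their analysis
  -- operator is the transpose, which is bounded above and below on `ℓ^2`.
  obtain ⟨A, B, hAB⟩ := exists_isHilbertFrame_of_enorm_le (e := e) hK hL
    (fun f => by
      rw [hcoef, hnorm]
      exact hlow 2 h12 _ (by rw [← hnorm]; exact enorm_ne_top))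
    (fun f => by rw [hcoef, hnorm]; exact hup 2 h12 _)
  have hG : IsConvDom (fun i i' => inner ℂ (e i) (e i')) πI πI :=
    IsConvDom.of_enorm_le_tsum hJ hT hS fun i i' => by
      rw [lp.inner_eq_tsum]
      refine enorm_tsum_le_tsum_enorm.trans (ENNReal.tsum_le_tsum fun j => ?_)
      rw [RCLike.inner_apply, enorm_mul, RCLike.enorm_conj, mul_comm, he, he]
  obtain ⟨e', h1, -, h3⟩ := hAB.exists_dual hI hG
  refine ⟨fun i j => inner ℂ (e' i) (lp.single 2 j (1 : ℂ)),
    h3 (fun j => lp.single 2 j (1 : ℂ)) πJ (hS.of_enorm_le_transpose fun i j => ?_),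
    fun j j' => ?_⟩
  · rw [lp.inner_single_right, RCLike.inner_apply, he, one_mul, RCLike.enorm_conj]
  -- Reconstruction of the unit vector at `j'`, read off at the coordinate `j`, is the identity `S R
  -- = 1`.
  · have h4 := hasSum_inner_mul_inner (h1 (lp.single 2 j' (1 : ℂ))) (lp.single 2 j (1 : ℂ))
    simp only [lp.inner_single_left, RCLike.inner_apply, map_one, mul_one, he] at h4
    rw [h4.tsum_eq, lp.single_apply, Pi.single_apply]

/-- Surjectivity of a convolution-dominated matrix on `ℓ^p` does not depend on `p`. -/
theorem exists_preimage_of_exists_preimage (hI : IsSited .count πI N) (hJ : IsSited .count πJ N)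
    {S : J → I → ℂ} (hS : IsConvDom S πJ πI) {p q : ℝ≥0∞} (hp : 1 ≤ p) (hq : 1 ≤ q)
    (h : ∀ a : J → ℂ, eLpNorm a p .count ≠ ∞ →
      ∃ c : I → ℂ, eLpNorm c p .count ≠ ∞ ∧ ∀ j, ∑' i, S j i * c i = a j)
    (a : J → ℂ) (ha : eLpNorm a q .count ≠ ∞) :
    ∃ c : I → ℂ, eLpNorm c q .count ≠ ∞ ∧ ∀ j, ∑' i, S j i * c i = a j := by
  classical
  have hpp := ENNReal.HolderConjugate.conjExponent hp
  obtain ⟨C, hC, hpre⟩ := exists_preimage_eLpNorm_le hI hJ hS hp h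
  obtain ⟨R, hR, hSR⟩ := exists_right_inverse hI hJ hS
    (ENNReal.HolderConjugate.one_le p.conjExponent p) hC
    (isBoundedBelow_transpose hI hS hp hpp hC hpre)
  obtain ⟨L, hL, hRL⟩ := hR.exists_eLpNorm_le hJ hI
  refine ⟨fun i => ∑' j, R i j * a j, ne_top_of_le_ne_top (ENNReal.mul_ne_top hL ha) (hRL q hq a),
    fun j => ?_⟩
  rw [hS.tsum_mul_tsum hR hI hJ ha (enorm_le_of_eLpNorm_count a hq)]
  simp only [hSR, ite_mul, one_mul, zero_mul]
  exact tsum_ite_eq' j _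

end RightInverse

/-! ### Transfer of the interpolation property. -/

section Interpolation

variable {d : ℕ} {V : Submodule ℂ (Lp ℂ 2 (volume : Measure (EuclideanSpace ℝ (Fin d))))}
  {Λ : Set (EuclideanSpace ℝ (Fin d))}

lemma isInterpolatingSet_rangeSpace_iff (Φ : LocalizedFrame V) {p : ℝ≥0∞} (hp : 1 ≤ p) :
    IsInterpolatingSet (Φ.rangeSpace p) p Λ ↔ ∀ a : Λ → ℂ, eLpNorm a p .count ≠ ∞ →
      ∃ c : Φ.nodes → ℂ, eLpNorm c p .count ≠ ∞ ∧ ∀ l : Λ, ∑' γ, Φ.F γ l * c γ = a l := by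
  constructor
  · intro h a ha
    obtain ⟨f, hf, hfa⟩ := h ⟨a, (memℓp_iff_eLpNorm_count hp a).2 ha⟩
    obtain ⟨c, hc, rfl⟩ := (mem_rangeSpace_iff Φ hp f).1 hf
    exact ⟨c, hc, fun l => (synth_eq _ _ _).symm.trans (hfa l)⟩
  · intro h a
    obtain ⟨c, hc, hca⟩ := h a ((memℓp_iff_eLpNorm_count hp a).1 (lp.memℓp a))
    exact ⟨synth Φ.F c, (mem_rangeSpace_iff Φ hp _).2 ⟨c, hc, rfl⟩,
      fun l => (synth_eq _ _ _).trans (hca l)⟩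

/-- The spaces `V^p` do not depend on the frame. -/
theorem rangeSpace_subset
    (hV : IsClosed (V : Set (Lp ℂ 2 (volume : Measure (EuclideanSpace ℝ (Fin d))))))
    (Φ Ψ : LocalizedFrame V) {p : ℝ≥0∞} (hp : 1 ≤ p) : Φ.rangeSpace p ⊆ Ψ.rangeSpace p := by
  have hcΦ := Φ.relativelySeparated.countable
  intro f hf
  have hf2 := hf.2.1
  obtain ⟨c, hc, rfl⟩ := (mem_rangeSpace_iff Φ hp f).1 hf
  obtain ⟨Q, U, L, hL, -, hU, -, hFU, -, hUL⟩ := exists_transition hV Ψ Φ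
  exact (mem_rangeSpace_iff Ψ hp _).2
    ⟨_, ne_top_of_le_ne_top (ENNReal.mul_ne_top hL hf2.2.ne) (hUL p hp c hc),
      (synth_tsum_transition hU hFU hc (enorm_le_of_eLpNorm_count c hp)).symm⟩

/-- The exponent is changed first with `Φ` fixed, where the claim is surjectivity of one evaluation
matrix; the frame is then changed at the fixed exponent `q`. -/
theorem _root_.IsInterpolatingSet.rangeSpace
    (hV : IsClosed (V : Set (Lp ℂ 2 (volume : Measure (EuclideanSpace ℝ (Fin d))))))
    {Φ : LocalizedFrame V} (Ψ : LocalizedFrame V) (hΛ : RelativelySeparated Λ) {p q : ℝ≥0∞}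
    (hp : 1 ≤ p) (hq : 1 ≤ q) (h : IsInterpolatingSet (Φ.rangeSpace p) p Λ) :
    IsInterpolatingSet (Ψ.rangeSpace q) q Λ := by
  have hcΦ := Φ.relativelySeparated.countable
  have hcΛ := hΛ.countable
  obtain ⟨N₁, hN₁⟩ := Φ.relativelySeparated.exists_isSited
  obtain ⟨N₂, hN₂⟩ := hΛ.exists_isSited
  have hN : max N₁ N₂ ≠ ∞ := max_ne_top hN₁.ne_top hN₂.ne_top
  have hq' : IsInterpolatingSet (Φ.rangeSpace q) q Λ :=
    (isInterpolatingSet_rangeSpace_iff Φ hq).2 <| exists_preimage_of_exists_preimage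
      (hN₁.mono (le_max_left _ _) hN) (hN₂.mono (le_max_right _ _) hN)
      (Φ.isAtoms.isConvDom fun l : Λ => (l : EuclideanSpace ℝ (Fin d))) hp hq
      ((isInterpolatingSet_rangeSpace_iff Φ hp).1 h)
  intro a
  obtain ⟨f, hf, hfa⟩ := hq' a
  exact ⟨f, rangeSpace_subset hV Φ Ψ hq hf, hfa⟩

end Interpolation

end ConvDom

theorem mainTheorem8 {d : ℕ}
    (V : Submodule ℂ (Lp ℂ 2 (volume : Measure (EuclideanSpace ℝ (Fin d)))))
    (hV : IsClosed (V : Set (Lp ℂ 2 (volume : Measure (EuclideanSpace ℝ (Fin d))))))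
    (Φ Ψ : LocalizedFrame V)
    (Λ : Set (EuclideanSpace ℝ (Fin d))) (hΛ : RelativelySeparated Λ) :
    ((∃ p : ℝ≥0∞, 1 ≤ p ∧ IsSamplingSet (Φ.rangeSpace p) p Λ) →
      ∀ q : ℝ≥0∞, 1 ≤ q → IsSamplingSet (Ψ.rangeSpace q) q Λ) ∧
    ((∃ p : ℝ≥0∞, 1 ≤ p ∧ IsInterpolatingSet (Φ.rangeSpace p) p Λ) →
      ∀ q : ℝ≥0∞, 1 ≤ q → IsInterpolatingSet (Ψ.rangeSpace q) q Λ) :=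
  ⟨fun ⟨_, hp, h⟩ _ hq => h.rangeSpace hV Ψ hΛ hp hq,
    fun ⟨_, hp, h⟩ _ hq => h.rangeSpace hV Ψ hΛ hp hq⟩
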